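/- For complex parameters with $d\neq 0,1$, the Heun equation is $$u''+\Bigl(\frac{\gamma}{t}+\frac{\delta}{t-1}+\frac{\epsilon}{t-d}\Bigr)u'+\frac{\alpha\beta t-q}{t(t-1)(t-d)}\,u=0,\qquad \epsilon=\alpha+\beta-\gamma-\delta+1,$$ and $Hl(d,q;\alpha,\beta,\gamma,\delta;t)$ ($\gamma\ne 0,-1,-2,\dots$) is its power series solution at $t=0$ with constant term $1$. The equation has four singular points if none of the following holds: $\gamma=0,\ q=0$; $\ \delta=0,\ q=\alpha\beta$; $\ \epsilon=0,\ q=\alpha\beta d$; $\ \alpha\beta=0,\ \alpha+\beta=1,\ q=0$. It is nontrivial if $\alpha\beta\neq0$ or $q\ne0$. The hypergeometric equation is $$y''+\Bigl(\frac cz+\frac{a+b-c+1}{z-1}\Bigr)y'+\frac{ab}{z(z-1)}\,y=0 .$$ A *reduction of $Hl$ to ${}_2F_1$ by a rational transformation of the independent variable* is a nonconstant rational function $R$ with $R(0)=0$, together with $a,b,c$, such that the substitution $z=R(t)$ transforms the hypergeometric equation into the Heun equation (that is, the pulled-back equation $y''+\{[\frac{c}{R}+\frac{a+b-c+1}{R-1}]R'-\frac{R''}{R'}\}y'+\frac{ab\,R'^2}{R(R-1)}\,y=0$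 is the Heun equation), and, with neither $\gamma$ nor $c$ a nonpositive integer, $Hl(d,q;\alpha,\beta,\gamma,\delta;t)={}_2F_1(a,b;c;R(t))$ near $t=0$. Consider the following seven types, each given by a number $D$, a number $p$, a polynomial $R_1$, and conditions on exponent parameters $g_0,g_1,g_D$ at $0,1,D$ (signs: $\mathrm i=\sqrt{-1}$): 1. (1a) $D=2$, $p=1$, $R_1=t(2-t)$; $g_0=g_D$. 2. (1b) $D=4$, $p=1$, $R_1=(t-1)^2(1-t/4)$; $g_0=\frac12$, $1-g_1=2(1-g_D)$. 3. (1c) $D=2$, $p=1$, $R_1=4[t(2-t)-\frac12]^2$; $g_0=g_D$, $1-g_1=2(1-g_0)$. 4. (2a) $D=\frac12+\mathrm i\frac{\sqrt3}2$, $p=\frac12+\mathrm i\frac{\sqrt3}6$, $R_1=(1-t/p)^3$; $g_0=g_1=g_D$. 5. (2b) $D=\frac12+\mathrm i\frac{5\sqrt2}4$, $p=\frac12+\mathrm i\frac{\sqrt2}4$, $R_1=(1-t/D)(1-t/p)^3$; $g_0=g_1=\frac12$, $g_D=\frac23$. 6. (2c) $D=\frac12+\mathrm i\frac{11\sqrt{15}}{90}$,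 $p=\frac12+\mathrm i\frac{\sqrt{15}}{18}$, $R_1=-\mathrm i\frac{2025\sqrt{15}}{64}\,t(t-1)(t-p)^3$; $g_0=g_1=\frac23$, $g_D=\frac12$. 7. (2d) $D=\frac12+\mathrm i\frac{\sqrt3}2$, $p=\frac12+\mathrm i\frac{\sqrt3}6$, $R_1=4\{(1-t/p)^3-\frac12\}^2$; $g_0=g_1=g_D=\frac23$. A reduction by a polynomial $R$ is of a given type if there is an affine map $A(t)=mt+k$, $m\ne0$, with $A(\{0,1,d\})=\{0,1,D\}$ and $mq+\alpha\beta k=\alpha\beta p$, such that $R$ or $1-R$ equals $R_1\circ A$, and the conditions of the type hold when $g_0,g_1,g_D$ are the exponent parameters (out of $\gamma,\delta,\epsilon$, belonging to $t=0,1,d$ respectively) at the points $A^{-1}(0),A^{-1}(1),A^{-1}(D)$. **Theorem.** (i) Suppose a Heun equation has four singular points and is nontrivial. If its local Heun function is reduced to ${}_2F_1$ by a rational transformation $R$ of the independent variable, then $\alpha\beta\neq 0$, $R$ is a polynomial of degree $2$, $3$, $4$, $5$ or $6$, and there is exactly one of the seven types such that the reduction is of that type, $\deg R$ equals the degree of the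 type ($2,3,4,3,4,5,6$, respectively), and $d$ lies on the cross-ratio orbit $\{D,1-D,\frac1D,\frac1{1-D},\frac D{D-1},\frac{D-1}D\}$ of $D$. (ii) Each of the seven types occurs: there are Heun equations with four singular points that are nontrivial and have a reduction of that type. (iii) The following are representative reductions of the seven types, in this order. In them $\alpha,\beta,\gamma$ are free parameters, the upper or the lower signs are taken throughout, and each equality holds in a neighborhood of $t=0$ whenever the fifth argument of $Hl$ (which equals the third of ${}_2F_1$) is not a nonpositive integer. $$Hl(2,\alpha\beta;\alpha,\beta,\gamma,\alpha+\beta-2\gamma+1;t)={}_2F_1(\tfrac\alpha2,\tfrac\beta2;\gamma;t(2-t)),$$ $$Hl(4,\alpha\beta;\alpha,\beta,\tfrac12,\tfrac{2(\alpha+\beta)}3;t)={}_2F_1(\tfrac\alpha3,\tfrac\beta3;\tfrac12;1-(t-1)^2(1-t/4)),$$ $$Hl(2,\alpha\beta;\alpha,\beta,\tfrac{\alpha+\beta+2}4,\tfrac{\alpha+\beta}2;t)={}_2F_1(\tfrac\alpha4,\tfrac\beta4;\tfrac{\alpha+\beta+2}4;1-4[t(2-t)-\tfrac12]^2),$$ and,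 with $D=\frac12\pm\mathrm i\frac{\sqrt3}2$, $p=\frac12\pm\mathrm i\frac{\sqrt3}6$, $$Hl(D,\alpha\beta p;\alpha,\beta,\tfrac{\alpha+\beta+1}3,\tfrac{\alpha+\beta+1}3;t)={}_2F_1(\tfrac\alpha3,\tfrac\beta3;\tfrac{\alpha+\beta+1}3;1-(1-t/p)^3);$$ with $D=\frac12\pm\mathrm i\frac{5\sqrt2}4$, $p=\frac12\pm\mathrm i\frac{\sqrt2}4$, $$Hl(D,\alpha(\tfrac23-\alpha)p;\alpha,\tfrac23-\alpha,\tfrac12,\tfrac12;t)={}_2F_1(\tfrac\alpha4,\tfrac16-\tfrac\alpha4;\tfrac12;1-(1-t/D)(1-t/p)^3);$$ with $D=\frac12\pm\mathrm i\frac{11\sqrt{15}}{90}$, $p=\frac12\pm\mathrm i\frac{\sqrt{15}}{18}$, $$Hl(D,\alpha(\tfrac56-\alpha)p;\alpha,\tfrac56-\alpha,\tfrac23,\tfrac23;t)={}_2F_1(\tfrac\alpha5,\tfrac16-\tfrac\alpha5;\tfrac23;(\mp\mathrm i\tfrac{2025\sqrt{15}}{64})\,t(t-1)(t-p)^3);$$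 with $D=\frac12\pm\mathrm i\frac{\sqrt3}2$, $p=\frac12\pm\mathrm i\frac{\sqrt3}6$, $$Hl(D,\alpha(1-\alpha)p;\alpha,1-\alpha,\tfrac23,\tfrac23;t)={}_2F_1(\tfrac\alpha6,\tfrac16-\tfrac\alpha6;\tfrac23;1-4\{(1-t/p)^3-\tfrac12\}^2).$$ -/

import Mathlib

noncomputable section

namespace HeunReduction

open Polynomial Filter Topology

/-- The parameters of the Heun equation
`u'' + (γ/t + δ/(t-1) + ε/(t-d)) u' + (α β t - q)/(t (t-1) (t-d)) u = 0`,
where `ε` is fixed by Fuchs's relation `α + β - γ - δ - ε + 1 = 0`. -/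
structure HeunEquation where
  /-- the fourth singular point -/
  d : ℂ
  /-- the accessory parameter -/
  q : ℂ
  /-- first exponent at infinity -/
  α : ℂ
  /-- second exponent at infinity -/
  β : ℂ
  /-- exponent parameter at `t = 0` -/
  γ : ℂ
  /-- exponent parameter at `t = 1` -/
  δ : ℂ

namespace HeunEquation

variable (H : HeunEquation)

/-- The exponent parameter at `t = d`, given by Fuchs's relation. -/
def ε : ℂ := H.α + H.β - H.γ - H.δ + 1

/-- The coefficient of `u'` in the Heun equation. -/
def coeffP (t : ℂ) : ℂ := H.γ / t + H.δ / (t - 1) + H.ε / (t - H.d)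

/-- The coefficient of `u` in the Heun equation. -/
def coeffQ (t : ℂ) : ℂ := (H.α * H.β * t - H.q) / (t * (t - 1) * (t - H.d))

/-- The points `0, 1, d, ∞` are distinct, and each of them is a singular point of the equation.
The four negated conditions are those under which the singular point at
`0`, `1`, `d`, `∞`, respectively, is absent. -/
def HasFourSingularPoints : Prop :=
  H.d ≠ 0 ∧ H.d ≠ 1 ∧
  ¬ (H.γ = 0 ∧ H.q = 0) ∧
  ¬ (H.δ = 0 ∧ H.q = H.α * H.β) ∧
  ¬ (H.ε = 0 ∧ H.q = H.α * H.β * H.d) ∧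
  ¬ (H.α * H.β = 0 ∧ H.α + H.β = 1 ∧ H.q = 0)

/-- The equation is nontrivial: the coefficient of `u` does not vanish identically. -/
def IsNontrivial : Prop := H.α * H.β ≠ 0 ∨ H.q ≠ 0

/-- The exponent parameter at the finite point `x`, i.e. the residue of the coefficient of `u'`
there: the exponents of the equation at `x ∈ {0, 1, d}` are `0` and `1 - H.exponentAt x`. -/
def exponentAt (x : ℂ) : ℂ :=
  if x = 0 then H.γ else if x = 1 then H.δ else if x = H.d then H.ε else 0

end HeunEquation

/-- The coefficients of the Heun series: the power series solution at `t = 0` of the Heun equation,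
belonging to the exponent `0` and normalized to have constant term `1`. They satisfy
`d (n+1) (n+γ) cₙ₊₁ - (n ((n-1+γ)(1+d) + d δ + ε) + q) cₙ + (n-1+α)(n-1+β) cₙ₋₁ = 0`, with
`c₋₁ = 0`. -/
def heunCoeff (d q α β γ δ : ℂ) : ℕ → ℂ
  | 0 => 1
  | 1 => q / (d * γ)
  | n + 2 =>
    (((n + 1) * ((n + γ) * (1 + d) + d * δ + (α + β - γ - δ + 1)) + q) *
          heunCoeff d q α β γ δ (n + 1)
        - (n + α) * (n + β) * heunCoeff d q α β γ δ n) /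
      (d * (n + 2) * (n + 1 + γ))

/-- The local Heun function `Hl(d, q; α, β, γ, δ; t)`, defined if `γ` is not a nonpositive
integer (and `d ≠ 0, 1`), for `t` near `0`. -/
def Hl (d q α β γ δ t : ℂ) : ℂ := ∑' n : ℕ, heunCoeff d q α β γ δ n * t ^ n

/-- `x` is not one of `0, -1, -2, …`. -/
def NotNonposInt (x : ℂ) : Prop := ∀ n : ℕ, x ≠ -(n : ℂ)

/-- The coefficient of `y'` in the hypergeometric equation
`y'' + (c/z + (a+b-c+1)/(z-1)) y' + a b/(z (z-1)) y = 0`. -/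
def hyperP (a b c z : ℂ) : ℂ := c / z + (a + b - c + 1) / (z - 1)

/-- The coefficient of `y` in the hypergeometric equation. -/
def hyperQ (a b z : ℂ) : ℂ := a * b / (z * (z - 1))

/-- The value of a rational function at a point. -/
abbrev ratEval (R : RatFunc ℂ) (t : ℂ) : ℂ := R.eval (RingHom.id ℂ) t

/-- The rational substitution `z = R(t)` transforms the hypergeometric equation with parameters
`a, b; c` to the Heun equation `H`: `R` is not constant, and the pulled-back equation
`y'' + (P(R) R' - R''/R') y' + Q(R) R'² y = 0` is the Heun equation, as an identity of rational
functions of `t`. -/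
def Transforms (H : HeunEquation) (a b c : ℂ) (R : RatFunc ℂ) : Prop :=
  (∀ k : ℂ, R ≠ RatFunc.C k) ∧
  ∀ᶠ t in cofinite,
    H.coeffP t = hyperP a b c (ratEval R t) * deriv (ratEval R) t
        - deriv (deriv (ratEval R)) t / deriv (ratEval R) t ∧
    H.coeffQ t = hyperQ a b (ratEval R t) * deriv (ratEval R) t ^ 2

/-- A reduction of the local Heun function of `H` to `₂F₁(a, b; c; ·)` by the rational change of
variable `z = R(t)`: this change of variable transforms the two differential equations into each
other, it takes `t = 0` to `z = 0`, both functions are defined,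
and `Hl(t) = ₂F₁(R(t))` near `t = 0`. -/
structure IsHlReduction (H : HeunEquation) (a b c : ℂ) (R : RatFunc ℂ) : Prop where
  transforms : Transforms H a b c R
  gamma_ok : NotNonposInt H.γ
  c_ok : NotNonposInt c
  map_zero : R.num.eval 0 = 0
  identity : ∀ᶠ t in 𝓝 (0 : ℂ),
    Hl H.d H.q H.α H.β H.γ H.δ t = ₂F₁ a b c (ratEval R t)

/-- The cross-ratio orbit of `D`. -/
def crossRatioOrbit (D : ℂ) : Set ℂ :=
  {D, 1 - D, 1 / D, 1 / (1 - D), D / (D - 1), (D - 1) / D}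

/-- The seven types of reduction. -/
inductive ReductionType
  | harmonic
  | realCubic
  | specialHarmonic
  | equianharmonic
  | quartic
  | quintic
  | specialEquianharmonic

namespace ReductionType

/-- The representative value `D` of the fourth singular point. -/
def D : ReductionType → ℂ
  | harmonic => 2
  | realCubic => 4
  | specialHarmonic => 2
  | equianharmonic => 1 / 2 + Complex.I * (√3 : ℝ) / 2
  | quartic => 1 / 2 + Complex.I * (5 * (√2 : ℝ) / 4)
  | quintic => 1 / 2 + Complex.I * (11 * (√15 : ℝ) / 90)
  | specialEquianharmonic => 1 / 2 + Complex.I * (√3 : ℝ) / 2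

/-- The value of the normalized accessory parameter `q / (α β)` when `d = D`. -/
def p : ReductionType → ℂ
  | harmonic => 1
  | realCubic => 1
  | specialHarmonic => 1
  | equianharmonic => 1 / 2 + Complex.I * (√3 : ℝ) / 6
  | quartic => 1 / 2 + Complex.I * (√2 : ℝ) / 4
  | quintic => 1 / 2 + Complex.I * (√15 : ℝ) / 18
  | specialEquianharmonic => 1 / 2 + Complex.I * (√3 : ℝ) / 6

/-- The degree of the polynomial substitution. -/
def degree : ReductionType → ℕ
  | harmonic => 2
  | realCubic => 3
  | specialHarmonic => 4
  | equianharmonic => 3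
  | quartic => 4
  | quintic => 5
  | specialEquianharmonic => 6

/-- The canonical polynomial substitution when `d = D`. -/
def poly : ReductionType → ℂ[X]
  | harmonic => X * (2 - X)
  | realCubic => (X - 1) ^ 2 * (1 - C (1 / 4) * X)
  | specialHarmonic => 4 * (X * (2 - X) - C (1 / 2)) ^ 2
  | equianharmonic => (1 - C (1 / equianharmonic.p) * X) ^ 3
  | quartic => (1 - C (1 / quartic.D) * X) * (1 - C (1 / quartic.p) * X) ^ 3
  | quintic => C (-Complex.I * (2025 * (√15 : ℝ) / 64)) * X * (X - 1) * (X - C quintic.p) ^ 3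
  | specialEquianharmonic =>
      4 * ((1 - C (1 / specialEquianharmonic.p) * X) ^ 3 - C (1 / 2)) ^ 2

/-- The conditions on the exponent parameters `g₀, g₁, gD` at the points `0, 1, D` when
`d = D`. -/
def exponentCondition : ReductionType → ℂ → ℂ → ℂ → Prop
  | harmonic, g₀, _, gD => g₀ = gD
  | realCubic, g₀, g₁, gD => g₀ = 1 / 2 ∧ 1 - g₁ = 2 * (1 - gD)
  | specialHarmonic, g₀, g₁, gD => g₀ = gD ∧ 1 - g₁ = 2 * (1 - g₀)
  | equianharmonic, g₀, g₁, gD => g₀ = g₁ ∧ g₁ = gD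
  | quartic, g₀, g₁, gD => g₀ = 1 / 2 ∧ g₁ = 1 / 2 ∧ gD = 2 / 3
  | quintic, g₀, g₁, gD => g₀ = 2 / 3 ∧ g₁ = 2 / 3 ∧ gD = 1 / 2
  | specialEquianharmonic, g₀, g₁, gD => g₀ = 2 / 3 ∧ g₁ = 2 / 3 ∧ gD = 2 / 3

end ReductionType

/-- The Heun equation `H` and the polynomial substitution `P` are of type `τ`: some affine map
`A(t) = m t + k` takes `{0, 1, d}` onto `{0, 1, D}` (the triangles are similar), takes
`q / (α β)` to `p`, and takes the exponent parameters of `H` to ones that satisfy the conditions of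
the type; and `P` or `1 - P` is the canonical polynomial of the type, composed with `A`. -/
def IsOfType (τ : ReductionType) (H : HeunEquation) (P : ℂ[X]) : Prop :=
  ∃ m k : ℂ, m ≠ 0 ∧
    (fun t : ℂ => m * t + k) '' {0, 1, H.d} = {0, 1, τ.D} ∧
    m * H.q + H.α * H.β * k = H.α * H.β * τ.p ∧
    τ.exponentCondition (H.exponentAt ((0 - k) / m)) (H.exponentAt ((1 - k) / m))
      (H.exponentAt ((τ.D - k) / m)) ∧
    (P = τ.poly.comp (C m * X + C k) ∨ 1 - P = τ.poly.comp (C m * X + C k))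

/-- The polynomial substitution `z = P(t)` gives a reduction of the local Heun function of `H` to
`₂F₁(a, b; c; ·)`, and this reduction is of type `τ`. -/
def IsHlReductionOfType (τ : ReductionType) (H : HeunEquation) (a b c : ℂ) (P : ℂ[X]) : Prop :=
  IsHlReduction H a b c (algebraMap ℂ[X] (RatFunc ℂ) P) ∧ IsOfType τ H P

end HeunReduction

end

open HeunReduction HeunReduction.HeunEquation Polynomial Filter Topology

namespace HeunReduction

/-- `f` is the sum of the power series with coefficients `a` near `0`. -/
def HasSeries (a : ℕ → ℂ) (f : ℂ → ℂ) : Prop :=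
  ∀ᶠ t in 𝓝 (0 : ℂ), HasSum (fun n => a n * t ^ n) (f t)

lemma hasSeries_iff {a : ℕ → ℂ} {f : ℂ → ℂ} :
    HasSeries a f ↔ HasFPowerSeriesAt f (FormalMultilinearSeries.ofScalars ℂ a) 0 := by
  rw [hasFPowerSeriesAt_iff]
  simp [HasSeries, FormalMultilinearSeries.coeff_ofScalars, mul_comm]

lemma HasSeries.congr {a : ℕ → ℂ} {f g : ℂ → ℂ} (h : HasSeries a f) (hfg : f =ᶠ[𝓝 0] g) :
    HasSeries a g := by
  filter_upwards [h, hfg] with t h1 h2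
  rwa [← h2]

lemma HasSeries.add {a b : ℕ → ℂ} {f g : ℂ → ℂ} (hf : HasSeries a f) (hg : HasSeries b g) :
    HasSeries (fun n => a n + b n) (fun t => f t + g t) := by
  filter_upwards [hf, hg] with t h1 h2
  simpa [add_mul] using h1.add h2

lemma HasSeries.const_mul {a : ℕ → ℂ} {f : ℂ → ℂ} (k : ℂ) (hf : HasSeries a f) :
    HasSeries (fun n => k * a n) (fun t => k * f t) := by
  filter_upwards [hf] with t h1
  simpa [mul_assoc] using h1.mul_left k

/-- The coefficients of `t * f t`. -/
def shiftCoeff (a : ℕ → ℂ) : ℕ → ℂ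
  | 0 => 0
  | n + 1 => a n

lemma HasSeries.shift {a : ℕ → ℂ} {f : ℂ → ℂ} (hf : HasSeries a f) :
    HasSeries (shiftCoeff a) (fun t => t * f t) := by
  filter_upwards [hf] with t h1
  rw [← hasSum_nat_add_iff' 1]
  simpa [shiftCoeff, pow_succ, mul_assoc, mul_comm, mul_left_comm] using h1.mul_left t

lemma HasSeries.deriv {a : ℕ → ℂ} {f : ℂ → ℂ} (hf : HasSeries a f) :
    HasSeries (fun n => (n + 1) * a (n + 1)) (deriv f) := by
  obtain ⟨r, hr⟩ := hasSeries_iff.1 hf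
  have h := hr.fderiv
  have h2 := (ContinuousLinearMap.apply ℂ ℂ (1 : ℂ)).comp_hasFPowerSeriesOnBall h
  have h3 := hasFPowerSeriesAt_iff.1 h2.hasFPowerSeriesAt
  filter_upwards [h3] with t ht
  have hc : ∀ n, (((ContinuousLinearMap.apply ℂ ℂ) 1).compFormalMultilinearSeries
      (FormalMultilinearSeries.ofScalars ℂ a).derivSeries).coeff n = (n + 1) * a (n + 1) := by
    intro n
    have := FormalMultilinearSeries.derivSeries_coeff_one
      (FormalMultilinearSeries.ofScalars ℂ a) n
    rw [FormalMultilinearSeries.coeff_ofScalars] at this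
    refine Eq.trans ?_ (this.trans (by simp))
    rfl
  simp only [hc, zero_add] at ht
  simpa [mul_comm] using ht

lemma HasSeries.unique {a b : ℕ → ℂ} {f : ℂ → ℂ} (hf : HasSeries a f) (hg : HasSeries b f) :
    a = b := by
  have := (hasSeries_iff.1 hf).eq_formalMultilinearSeries (hasSeries_iff.1 hg)
  ext n
  simpa [FormalMultilinearSeries.coeff_ofScalars] using
    congrArg (fun p => FormalMultilinearSeries.coeff p n) this

lemma exists_hasSeries {f : ℂ → ℂ} (hf : AnalyticAt ℂ f 0) : ∃ a, HasSeries a f := by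
  obtain ⟨p, hp⟩ := hf
  refine ⟨p.coeff, ?_⟩
  filter_upwards [hasFPowerSeriesAt_iff.1 hp] with t ht
  simpa [mul_comm] using ht

lemma HasSeries.analyticAt {a : ℕ → ℂ} {f : ℂ → ℂ} (hf : HasSeries a f) : AnalyticAt ℂ f 0 :=
  (hasSeries_iff.1 hf).analyticAt

lemma hasSeries_zero : HasSeries (fun _ => 0) (fun _ => 0) :=
  Eventually.of_forall fun t => by simp

lemma HasSeries.coeff_zero {a : ℕ → ℂ} {f : ℂ → ℂ} (hf : HasSeries a f) : a 0 = f 0 := by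
  have := hf.self_of_nhds
  have h2 : HasSum (fun n => a n * (0 : ℂ) ^ n) (a 0) := by
    convert hasSum_single 0 _ using 1
    · simp
    · intro n hn; simp [hn]
  exact h2.unique this

lemma hasSeries_hypergeometric (a b c : ℂ) :
    HasSeries (ordinaryHypergeometricCoefficient a b c) (₂F₁ a b c) := by
  rw [hasSeries_iff]
  have hpos : 0 < (ordinaryHypergeometricSeries ℂ a b c).radius := by
    by_cases h : ∀ kn : ℕ, (kn : ℂ) ≠ -a ∧ (kn : ℂ) ≠ -b ∧ (kn : ℂ) ≠ -c
    · rw [ordinaryHypergeometricSeries_radius_eq_one ℂ a b c h]; exact one_pos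
    · have : (ordinaryHypergeometricSeries ℂ a b c).radius = ⊤ := by
        push Not at h
        obtain ⟨k, hk⟩ := h
        by_cases ha : (k : ℂ) = -a
        · obtain rfl : a = -k := by rw [ha]; ring
          exact ordinaryHypergeometric_radius_top_of_neg_nat₁ ℂ b c
        by_cases hb : (k : ℂ) = -b
        · obtain rfl : b = -k := by rw [hb]; ring
          exact ordinaryHypergeometric_radius_top_of_neg_nat₂ ℂ a c
        obtain rfl : c = -k := by rw [hk ha hb]; ring
        exact ordinaryHypergeometric_radius_top_of_neg_nat₃ ℂ a b
      rw [this]; exact ENNReal.coe_lt_top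
  exact ((ordinaryHypergeometricSeries ℂ a b c).hasFPowerSeriesOnBall hpos).hasFPowerSeriesAt

lemma NotNonposInt.add_ne_zero {c : ℂ} (hc : NotNonposInt c) (n : ℕ) : (n : ℂ) + c ≠ 0 :=
  fun h => hc n (by linear_combination h)

lemma hypergeometricCoefficient_succ {a b c : ℂ} (hc : NotNonposInt c) (n : ℕ) :
    (n + 1) * (n + c) * ordinaryHypergeometricCoefficient a b c (n + 1) =
      (n + a) * (n + b) * ordinaryHypergeometricCoefficient a b c n := by
  have h1 := hc.add_ne_zero n
  have h2 : (n : ℂ) + 1 ≠ 0 := Nat.cast_add_one_ne_zero n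
  have h3 : ((n.factorial : ℕ) : ℂ) ≠ 0 := Nat.cast_ne_zero.2 n.factorial_ne_zero
  have h4 : (ascPochhammer ℂ n).eval c ≠ 0 := by
    rw [Ne, ascPochhammer_eval_eq_zero_iff]
    rintro ⟨k, -, hk⟩
    exact hc k (by rw [hk]; ring)
  have h1' : c + n ≠ 0 := by rwa [add_comm]
  simp only [ordinaryHypergeometricCoefficient, Nat.factorial_succ, ascPochhammer_succ_eval]
  push_cast
  field_simp
  ring

/-- The hypergeometric equation, with denominators cleared, holds near `0`. -/
lemma hypergeometric_ode {a b c : ℂ} (hc : NotNonposInt c) :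
    ∀ᶠ z in 𝓝 (0 : ℂ), z * (z - 1) * deriv (deriv (₂F₁ a b c)) z
      + (c * (z - 1) + (a + b - c + 1) * z) * deriv (₂F₁ a b c) z
      + a * b * ₂F₁ a b c z = 0 := by
  have h0 := hasSeries_hypergeometric a b c
  set u := ordinaryHypergeometricCoefficient a b c
  have h1 := h0.deriv
  have h2 := h1.deriv
  have key := ((((h2.shift.shift.add (h2.shift.const_mul (-1))).add
    (h1.shift.const_mul (a + b + 1))).add (h1.const_mul (-c))).add (h0.const_mul (a * b)))
  have hz : (fun n => shiftCoeff (shiftCoeff fun n => (n + 1) * ((((n + 1 : ℕ) : ℂ) + 1) * u (n + 1 + 1))) n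
      + -1 * shiftCoeff (fun n => (n + 1) * ((((n + 1 : ℕ) : ℂ) + 1) * u (n + 1 + 1))) n
      + (a + b + 1) * shiftCoeff (fun n => (n + 1) * u (n + 1)) n
      + -c * ((n + 1) * u (n + 1)) + a * b * u n) = fun _ => 0 := by
    ext n
    have hr := fun n => hypergeometricCoefficient_succ (a := a) (b := b) hc n
    rcases n with _ | _ | n
    · simp only [shiftCoeff]
      have := hr 0
      push_cast at this ⊢
      linear_combination -this
    · simp only [shiftCoeff]
      have := hr 1
      push_cast at this ⊢
      linear_combination -this
    · simp only [shiftCoeff]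
      have := hr (n + 2)
      push_cast at this ⊢
      linear_combination -this
  rw [hz] at key
  filter_upwards [key] with z hzs
  have h0s : HasSum (fun n : ℕ => (0 : ℂ) * z ^ n) 0 := by simp [hasSum_zero]
  have := hzs.unique h0s
  linear_combination this

lemma heunCoeff_unique {d q α β γ δ : ℂ} (hd : d ≠ 0) (hγ : NotNonposInt γ) {a : ℕ → ℂ}
    (h0 : a 0 = 1) (h1 : d * γ * a 1 = q * a 0)
    (hrec : ∀ n : ℕ, d * (n + 2) * (n + 1 + γ) * a (n + 2) =
      ((n + 1) * ((n + γ) * (1 + d) + d * δ + (α + β - γ - δ + 1)) + q) * a (n + 1)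
        - (n + α) * (n + β) * a n) : a = heunCoeff d q α β γ δ := by
  have key : ∀ n : ℕ, a n = heunCoeff d q α β γ δ n ∧ a (n + 1) = heunCoeff d q α β γ δ (n + 1) := by
    intro n
    induction n with
    | zero =>
      refine ⟨by simp [h0, heunCoeff], ?_⟩
      have : γ ≠ 0 := by simpa using hγ.add_ne_zero 0
      simp only [heunCoeff]
      rw [eq_div_iff (mul_ne_zero hd this)]
      rw [h0] at h1
      linear_combination h1
    | succ n ih =>
      refine ⟨ih.2, ?_⟩
      have h3 := hγ.add_ne_zero (n + 1)
      have h4 : (n : ℂ) + 2 ≠ 0 := by exact_mod_cast (by omega : n + 2 ≠ 0)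
      push_cast at h3
      simp only [heunCoeff]
      rw [eq_div_iff (mul_ne_zero (mul_ne_zero hd h4) h3), ← ih.1, ← ih.2]
      linear_combination hrec n
  ext n
  exact (key n).1

/-- A power series solution of the Heun equation with constant term `1` is the local Heun
function. -/
lemma Hl_eq_of_ode {d q α β γ δ : ℂ} (hd : d ≠ 0) (hγ : NotNonposInt γ) {f : ℂ → ℂ}
    (hf : AnalyticAt ℂ f 0) (h0 : f 0 = 1)
    (hode : ∀ᶠ t in 𝓝[≠] (0 : ℂ), t * (t - 1) * (t - d) * deriv (deriv f) t
      + (γ * (t - 1) * (t - d) + δ * t * (t - d) + (α + β - γ - δ + 1) * t * (t - 1)) * deriv f t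
      + (α * β * t - q) * f t = 0) :
    ∀ᶠ t in 𝓝 (0 : ℂ), Hl d q α β γ δ t = f t := by
  obtain ⟨a, ha⟩ := exists_hasSeries hf
  have h1 := ha.deriv
  have h2 := h1.deriv
  have key := (((h2.shift.shift.shift.add (h2.shift.shift.const_mul (-(1 + d)))).add
    (h2.shift.const_mul d)).add (((h1.shift.shift.const_mul (α + β + 1)).add
    (h1.shift.const_mul (-(γ * (1 + d) + δ * d + (α + β - γ - δ + 1))))).add
    (h1.const_mul (γ * d)))).add ((ha.shift.const_mul (α * β)).add (ha.const_mul (-q)))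
  have hz := key.congr (g := fun _ => 0) <| by
    have hA := key.analyticAt
    refine (hA.frequently_eq_iff_eventually_eq analyticAt_const).1 (Eventually.frequently ?_)
    filter_upwards [hode] with t ht
    linear_combination ht
  have hcoef := fun n => congrFun (hz.unique hasSeries_zero) n
  have hsum : a = heunCoeff d q α β γ δ := by
    refine heunCoeff_unique hd hγ (by rw [ha.coeff_zero, h0]) ?_ ?_
    · have := hcoef 0
      simp only [shiftCoeff] at this
      push_cast at this
      linear_combination this
    · intro n
      have := hcoef (n + 1)
      rcases n with _ | _ | n
      · simp only [shiftCoeff] at this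
        push_cast at this ⊢
        linear_combination this
      · simp only [shiftCoeff] at this
        push_cast at this ⊢
        linear_combination this
      · simp only [shiftCoeff] at this
        push_cast at this ⊢
        linear_combination this
  filter_upwards [ha] with t ht
  rw [Hl, ← hsum]
  exact ht.tsum_eq

end HeunReduction

namespace HeunReduction

lemma ratEval_algebraMap (P : ℂ[X]) :
    ratEval (algebraMap ℂ[X] (RatFunc ℂ) P) = fun t => P.eval t := by
  funext t
  simp [ratEval]

lemma deriv_polynomial (P : ℂ[X]) : deriv (fun t => P.eval t) = fun t => P.derivative.eval t :=
  funext fun _ => P.deriv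

lemma algebraMap_ne_C_iff {P : ℂ[X]} :
    (∀ k : ℂ, algebraMap ℂ[X] (RatFunc ℂ) P ≠ RatFunc.C k) ↔ derivative P ≠ 0 := by
  rw [Ne, derivative_eq_zero, natDegree_eq_zero]
  push Not
  refine forall_congr' fun k => ?_
  rw [← RatFunc.algebraMap_C, Ne, (RatFunc.algebraMap_injective ℂ).eq_iff, eq_comm]

/-- A polynomial transformation of the hypergeometric equation. -/
lemma transforms_algebraMap_iff {H : HeunEquation} {a b c : ℂ} {P : ℂ[X]} :
    Transforms H a b c (algebraMap ℂ[X] (RatFunc ℂ) P) ↔ derivative P ≠ 0 ∧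
      ∀ᶠ t in cofinite,
        H.coeffP t = hyperP a b c (P.eval t) * P.derivative.eval t
          - P.derivative.derivative.eval t / P.derivative.eval t ∧
        H.coeffQ t = hyperQ a b (P.eval t) * P.derivative.eval t ^ 2 := by
  rw [Transforms, algebraMap_ne_C_iff, ratEval_algebraMap]
  simp only [deriv_polynomial]

lemma eventually_eval_ne_zero {P : ℂ[X]} (hP : P ≠ 0) : ∀ᶠ t in cofinite, P.eval t ≠ 0 := by
  have := P.roots.toFinset.finite_toSet
  filter_upwards [this.compl_mem_cofinite] with t ht h
  exact ht (by simpa [hP] using h)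

lemma eventually_ne_cofinite (x : ℂ) : ∀ᶠ t in cofinite, t ≠ x :=
  (Set.finite_singleton x).compl_mem_cofinite

lemma punctured_le_cofinite (x : ℂ) : 𝓝[≠] x ≤ cofinite := by
  intro s hs
  have hf : (sᶜ \ {x}).Finite := hs.subset Set.sdiff_subset
  have h1 : (sᶜ \ {x})ᶜ ∈ 𝓝 x := hf.isClosed.isOpen_compl.mem_nhds (by simp)
  filter_upwards [mem_nhdsWithin_of_mem_nhds h1, self_mem_nhdsWithin] with t h2 h3
  by_contra h4
  exact h2 ⟨h4, h3⟩

lemma sub_C_ne_zero_of_derivative {P : ℂ[X]} (hP : derivative P ≠ 0) (k : ℂ) : P - C k ≠ 0 := by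
  intro h
  apply hP
  rw [sub_eq_zero.1 h, derivative_C]

lemma sub_one_ne_zero_of_derivative {P : ℂ[X]} (hP : derivative P ≠ 0) : P - 1 ≠ 0 := by
  simpa using sub_C_ne_zero_of_derivative hP 1

lemma ne_zero_of_derivative {P : ℂ[X]} (hP : derivative P ≠ 0) : P ≠ 0 := by
  simpa using sub_C_ne_zero_of_derivative hP 0

/-- A polynomial substitution that fixes `0` and transforms the equations into each other takes the
hypergeometric function to the local Heun function. -/
lemma Hl_eq_hypergeometric_comp {H : HeunEquation} {a b c : ℂ} {P : ℂ[X]}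
    (hT : Transforms H a b c (algebraMap ℂ[X] (RatFunc ℂ) P)) (hd : H.d ≠ 0)
    (hγ : NotNonposInt H.γ) (hc : NotNonposInt c) (hP0 : P.eval 0 = 0) :
    ∀ᶠ t in 𝓝 (0 : ℂ), Hl H.d H.q H.α H.β H.γ H.δ t = ₂F₁ a b c (P.eval t) := by
  rw [transforms_algebraMap_iff] at hT
  obtain ⟨hP, hT⟩ := hT
  have hF := (hasSeries_hypergeometric a b c).analyticAt
  set F : ℂ → ℂ := ₂F₁ a b c with hFdef
  have hPa : AnalyticAt ℂ (fun t => P.eval t) 0 := P.differentiable.analyticAt 0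
  have hcont : Tendsto (fun t => P.eval t) (𝓝 0) (𝓝 0) := by
    have := (Polynomial.continuous (p := P)).tendsto 0
    rwa [hP0] at this
  have hFan : ∀ᶠ t in 𝓝 (0 : ℂ), AnalyticAt ℂ F (P.eval t) :=
    hcont.eventually hF.eventually_analyticAt
  have hd1 : ∀ᶠ t in 𝓝 (0 : ℂ), deriv (fun t => F (P.eval t)) t =
      deriv F (P.eval t) * P.derivative.eval t := by
    filter_upwards [hFan] with t ht
    exact (ht.differentiableAt.hasDerivAt.comp t (P.hasDerivAt t)).deriv
  have hd2 : ∀ᶠ t in 𝓝 (0 : ℂ), deriv (deriv (fun t => F (P.eval t))) t =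
      deriv (deriv F) (P.eval t) * P.derivative.eval t ^ 2
        + deriv F (P.eval t) * P.derivative.derivative.eval t := by
    filter_upwards [hFan, hd1.eventually_nhds] with t ht h1
    rw [Filter.EventuallyEq.deriv_eq h1]
    have := (ht.deriv.differentiableAt.hasDerivAt.comp t (P.hasDerivAt t)).mul
      (P.derivative.hasDerivAt t)
    refine this.deriv.trans ?_
    simp only [Function.comp]
    ring
  refine Hl_eq_of_ode hd hγ (f := fun t => F (P.eval t)) (hF.comp_of_eq hPa hP0) ?_ ?_
  · simp [hP0, hFdef, ordinaryHypergeometric_zero]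
  · have hle := punctured_le_cofinite 0
    have hode := hcont.eventually (hypergeometric_ode (a := a) (b := b) hc)
    filter_upwards [hle hT, hle (eventually_eval_ne_zero hP),
      hle (eventually_eval_ne_zero (ne_zero_of_derivative hP)),
      hle (eventually_eval_ne_zero (sub_one_ne_zero_of_derivative hP)),
      hle (eventually_ne_cofinite 0), hle (eventually_ne_cofinite 1),
      hle (eventually_ne_cofinite H.d), mem_nhdsWithin_of_mem_nhds hd1,
      mem_nhdsWithin_of_mem_nhds hd2, mem_nhdsWithin_of_mem_nhds hode]
      with t ⟨hPt, hQt⟩ h1 h2 h3 h4 h5 h6 h7 h8 h9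
    rw [h7, h8]
    rw [← hFdef] at h9
    simp only [eval_sub, eval_one] at h3
    have h5' := sub_ne_zero.2 h5
    have h6' := sub_ne_zero.2 h6
    have e1 : H.γ * (t - 1) * (t - H.d) + H.δ * t * (t - H.d)
        + (H.α + H.β - H.γ - H.δ + 1) * t * (t - 1) = t * (t - 1) * (t - H.d) * H.coeffP t := by
      simp only [coeffP, ε]
      field_simp
    have e2 : H.α * H.β * t - H.q = t * (t - 1) * (t - H.d) * H.coeffQ t := by
      simp only [coeffQ]
      field_simp
    rw [e1, e2, hPt, hQt]
    have e3 : deriv (deriv F) (P.eval t) + hyperP a b c (P.eval t) * deriv F (P.eval t)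
        + hyperQ a b (P.eval t) * F (P.eval t) = 0 := by
      have h23 := mul_ne_zero h2 h3
      have : P.eval t * (P.eval t - 1) * (deriv (deriv F) (P.eval t)
        + hyperP a b c (P.eval t) * deriv F (P.eval t)
        + hyperQ a b (P.eval t) * F (P.eval t)) = 0 := by
        rw [← h9, hyperP, hyperQ]
        field_simp
      exact (mul_eq_zero.1 this).resolve_left h23
    have e4 : P.derivative.derivative.eval t / P.derivative.eval t * P.derivative.eval t
        = P.derivative.derivative.eval t := div_mul_cancel₀ _ h1
    linear_combination t * (t - 1) * (t - H.d) * P.derivative.eval t ^ 2 * e3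
      - t * (t - 1) * (t - H.d) * deriv F (P.eval t) * e4

lemma logDeriv_eval_eq_sum (K : ℂ) (M : Multiset ℂ) (t : ℂ)
    (h : (C K * (M.map fun x => X - C x).prod).eval t ≠ 0) :
    (derivative (C K * (M.map fun x => X - C x).prod)).eval t
      / (C K * (M.map fun x => X - C x).prod).eval t = (M.map fun x => 1 / (t - x)).sum := by
  induction M using Multiset.induction with
  | empty => simp
  | cons x M ih =>
    have e : C K * ((x ::ₘ M).map fun x => X - C x).prod
        = (X - C x) * (C K * (M.map fun x => X - C x).prod) := by
      rw [Multiset.map_cons, Multiset.prod_cons]; ring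
    rw [e] at h ⊢
    rw [eval_mul] at h
    have h1 := left_ne_zero_of_mul h
    have h2 := right_ne_zero_of_mul h
    rw [Multiset.map_cons, Multiset.sum_cons, ← ih h2, derivative_mul]
    simp only [eval_add, eval_mul (p := X - C x),
      derivative_sub, derivative_X, derivative_C, sub_zero, one_mul, eval_sub, eval_X, eval_C] at h1 ⊢
    field_simp

/-- A criterion for a polynomial to transform the equations, by factorizations. -/
lemma transforms_of_factors {H : HeunEquation} {a b c : ℂ} {P : ℂ[X]} {K₀ K₁ K₂ : ℂ}
    {M₀ M₁ M₂ : Multiset ℂ} (hK : K₂ ≠ 0)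
    (h₀ : P = C K₀ * (M₀.map fun x => X - C x).prod)
    (h₁ : P - 1 = C K₁ * (M₁.map fun x => X - C x).prod)
    (h₂ : derivative P = C K₂ * (M₂.map fun x => X - C x).prod)
    (hcP : ∀ t, H.coeffP t = c * (M₀.map fun x => 1 / (t - x)).sum
      + (a + b - c + 1) * (M₁.map fun x => 1 / (t - x)).sum
      - (M₂.map fun x => 1 / (t - x)).sum)
    (hcQ : ∀ t, (H.α * H.β * t - H.q) * P.eval t * (P.eval t - 1) =
      a * b * P.derivative.eval t ^ 2 * (t * (t - 1) * (t - H.d))) :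
    Transforms H a b c (algebraMap ℂ[X] (RatFunc ℂ) P) := by
  have hP : derivative P ≠ 0 := by
    rw [h₂]
    refine mul_ne_zero (C_ne_zero.2 hK) (Multiset.prod_ne_zero ?_)
    intro h
    obtain ⟨x, -, hx⟩ := Multiset.mem_map.1 h
    exact X_sub_C_ne_zero x hx
  refine transforms_algebraMap_iff.2 ⟨hP, ?_⟩
  filter_upwards [eventually_eval_ne_zero hP,
      eventually_eval_ne_zero (ne_zero_of_derivative hP),
      eventually_eval_ne_zero (sub_one_ne_zero_of_derivative hP),
      eventually_ne_cofinite 0, eventually_ne_cofinite 1,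
      eventually_ne_cofinite H.d] with t g1 g2 g3 g4 g5 g6
  constructor
  · rw [hcP t, ← logDeriv_eval_eq_sum K₀ M₀ t (by rwa [← h₀]),
      ← logDeriv_eval_eq_sum K₁ M₁ t (by rwa [← h₁]),
      ← logDeriv_eval_eq_sum K₂ M₂ t (by rwa [← h₂]), ← h₀, ← h₁, ← h₂, hyperP]
    simp only [derivative_sub, derivative_one, sub_zero, eval_sub, eval_one]
    ring
  · have g5' := sub_ne_zero.2 g5
    have g6' := sub_ne_zero.2 g6
    simp only [eval_sub, eval_one] at g3
    rw [coeffQ, hyperQ, div_mul_eq_mul_div, div_eq_div_iff (by positivity) (mul_ne_zero g2 g3)]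
    linear_combination hcQ t

end HeunReduction

namespace HeunReduction

open ReductionType

lemma equianharmonic_p_eq : equianharmonic.p ^ 2 - equianharmonic.p + 1 / 3 = 0 := by
  have h : ((√3 : ℝ) : ℂ) ^ 2 = 3 := by exact_mod_cast Real.sq_sqrt (by norm_num : (0 : ℝ) ≤ 3)
  simp only [ReductionType.p]
  linear_combination Complex.I ^ 2 / 36 * h + 1 / 12 * Complex.I_sq

lemma equianharmonic_D_eq : equianharmonic.D = 3 * equianharmonic.p - 1 := by
  simp only [ReductionType.p, ReductionType.D]; ring

lemma quartic_p_eq : quartic.p ^ 2 - quartic.p + 3 / 8 = 0 := by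
  have h : ((√2 : ℝ) : ℂ) ^ 2 = 2 := by exact_mod_cast Real.sq_sqrt (by norm_num : (0 : ℝ) ≤ 2)
  simp only [ReductionType.p]
  linear_combination Complex.I ^ 2 / 16 * h + 1 / 8 * Complex.I_sq

lemma quartic_D_eq : quartic.D = 5 * quartic.p - 2 := by
  simp only [ReductionType.p, ReductionType.D]; ring

lemma quintic_p_eq : quintic.p ^ 2 - quintic.p + 8 / 27 = 0 := by
  have h : ((√15 : ℝ) : ℂ) ^ 2 = 15 := by
    exact_mod_cast Real.sq_sqrt (by norm_num : (0 : ℝ) ≤ 15)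
  simp only [ReductionType.p]
  linear_combination Complex.I ^ 2 / 324 * h + 5 / 108 * Complex.I_sq

lemma quintic_D_eq : quintic.D = 11 / 5 * quintic.p - 3 / 5 := by
  simp only [ReductionType.p, ReductionType.D]; ring

lemma quintic_const_eq : -Complex.I * (2025 * (√15 : ℝ) / 64)
    = -(18225 / 32) * (quintic.p - 1 / 2) := by
  simp only [ReductionType.p]; ring

/-- A polynomial reduction is of a type, if `x₀, x₁, x` are the singular points corresponding to
`0, 1, D`. -/
lemma isOfType_of_perm {τ : ReductionType} {H : HeunEquation} {P : ℂ[X]} {x₀ x₁ x p m k : ℂ}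
    (hperm : [x₀, x₁, x].Perm [0, 1, H.d]) (hm : m ≠ 0) (h₀ : m * x₀ + k = 0)
    (h₁ : m * x₁ + k = 1) (hx : m * x + k = τ.D) (hp : m * p + k = τ.p)
    (hq : H.q = H.α * H.β * p)
    (hexp : τ.exponentCondition (H.exponentAt x₀) (H.exponentAt x₁) (H.exponentAt x))
    (hP : (∀ t, P.eval t = τ.poly.eval (m * t + k)) ∨
      ∀ t, 1 - P.eval t = τ.poly.eval (m * t + k)) : IsOfType τ H P := by
  refine ⟨m, k, hm, ?_, ?_, ?_, ?_⟩
  · have : ({0, 1, H.d} : Set ℂ) = {x₀, x₁, x} := by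
      ext t
      simpa using (hperm.mem_iff (a := t)).symm
    rw [this]
    simp [Set.image_insert_eq, h₀, h₁, hx]
  · rw [← hp, hq]; ring
  · have e₀ : (0 - k) / m = x₀ := by rw [div_eq_iff hm]; linear_combination -h₀
    have e₁ : (1 - k) / m = x₁ := by rw [div_eq_iff hm]; linear_combination -h₁
    have e : (τ.D - k) / m = x := by rw [div_eq_iff hm]; linear_combination -hx
    rwa [e₀, e₁, e]
  · refine hP.imp (fun h => ?_) fun h => ?_ <;>
    · refine Polynomial.funext fun t => ?_
      simp [h t]

lemma IsOfType.one_sub {τ : ReductionType} {H : HeunEquation} {P : ℂ[X]} (h : IsOfType τ H (1 - P)) :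
    IsOfType τ H P := by
  obtain ⟨m, k, h1, h2, h3, h4, h5⟩ := h
  exact ⟨m, k, h1, h2, h3, h4, by rwa [sub_sub_cancel, or_comm] at h5⟩

variable {H : HeunEquation} {R : ℂ[X]} {x y z p A : ℂ}

lemma isOfType_harmonic (hperm : [y, p, z].Perm [0, 1, H.d]) (hq : H.q = H.α * H.β * p)
    (hyz : y + z = 2 * p) (hA : A * (y - p) ^ 2 = 1) (hR : ∀ t, R.eval t = A * (t - p) ^ 2)
    (hexp : H.exponentAt y = H.exponentAt z) : IsOfType harmonic H R := by
  have hy : y - p ≠ 0 := by rintro h; simp [h] at hA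
  have hA' : A = 1 / (y - p) ^ 2 := by field_simp; exact hA
  refine isOfType_of_perm (m := -1 / (y - p)) (k := y / (y - p)) (p := p) hperm
    (div_ne_zero (by norm_num) hy) ?_ ?_ ?_ ?_ hq
    hexp (Or.inr fun t => ?_)
  · field_simp; ring
  · field_simp; ring
  · simp only [ReductionType.D]; field_simp; linear_combination -hyz
  · simp only [ReductionType.p]; field_simp; ring
  · simp only [ReductionType.poly, hR, hA', eval_mul, eval_sub, eval_X, eval_ofNat]
    field_simp; ring

lemma isOfType_realCubic (hperm : [z, p, y].Perm [0, 1, H.d]) (hq : H.q = H.α * H.β * p)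
    (hyz : 3 * (z - p) = -(y - p)) (hA : A * (y - p) ^ 3 = -27 / 4)
    (hR : ∀ t, R.eval t = A * (t - p) ^ 2 * (t - y))
    (h₁ : H.exponentAt z = 1 / 2) (h₂ : 1 - H.exponentAt p = 2 * (1 - H.exponentAt y)) :
    IsOfType realCubic H R := by
  have hy : y - p ≠ 0 := by rintro h; norm_num [h] at hA
  have hA' : A = -27 / 4 / (y - p) ^ 3 := by rw [eq_div_iff (by positivity)]; exact hA
  refine isOfType_of_perm (m := 3 / (y - p)) (k := 1 - 3 * p / (y - p)) (p := p) hperm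
    (div_ne_zero (by norm_num) hy)
    ?_ ?_ ?_ ?_ hq ⟨h₁, h₂⟩ (Or.inl fun t => ?_)
  · field_simp; linear_combination hyz
  · field_simp; ring
  · simp only [ReductionType.D]; field_simp; ring
  · simp only [ReductionType.p]; field_simp; ring
  · simp only [ReductionType.poly, hR, hA', eval_mul, eval_sub, eval_X, eval_pow, eval_one, eval_C]
    field_simp; ring

lemma isOfType_specialHarmonic (hperm : [y, p, z].Perm [0, 1, H.d]) (hq : H.q = H.α * H.β * p)
    (hyz : y + z = 2 * p) (hA : A * (y - p) ^ 4 = -4)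
    (hR : ∀ t, R.eval t = A * (t - p) ^ 2 * (t - y) * (t - z))
    (h₁ : H.exponentAt y = H.exponentAt z) (h₂ : 1 - H.exponentAt p = 2 * (1 - H.exponentAt y)) :
    IsOfType specialHarmonic H R := by
  have hy : y - p ≠ 0 := by rintro h; norm_num [h] at hA
  have hA' : A = -4 / (y - p) ^ 4 := by rw [eq_div_iff (by positivity)]; exact hA
  obtain rfl : z = 2 * p - y := by linear_combination hyz
  refine isOfType_of_perm (m := -1 / (y - p)) (k := y / (y - p)) (p := p) hperm
    (div_ne_zero (by norm_num) hy) ?_ ?_ ?_ ?_ hq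
    ⟨h₁, h₂⟩ (Or.inr fun t => ?_)
  · field_simp; ring
  · field_simp; ring
  · simp only [ReductionType.D]; field_simp; ring
  · simp only [ReductionType.p]; field_simp; ring
  · simp only [ReductionType.poly, hR, hA', eval_mul, eval_sub, eval_X, eval_ofNat, eval_pow, eval_C]
    field_simp; ring

/-- An equilateral triangle is similar to the triangle `0, 1, D`. -/
lemma exists_equianharmonic_affine {l : List ℂ} (hperm : [x, y, z].Perm l) (hx : x - p ≠ 0)
    (hsum : x + y + z = 3 * p)
    (hpair : (x - p) * (y - p) + (y - p) * (z - p) + (z - p) * (x - p) = 0) :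
    ∃ y' z' m k, [x, y', z'].Perm l ∧ m * (x - p) = -equianharmonic.p ∧
      k = equianharmonic.p - m * p ∧
      m * x + k = 0 ∧ m * y' + k = 1 ∧ m * z' + k = equianharmonic.D := by
  have hp := equianharmonic_p_eq
  rw [equianharmonic_D_eq]
  set e := equianharmonic.p
  have main : ∀ y z : ℂ, [x, y, z].Perm l → x + y + z = 3 * p → e * (y - p) = (e - 1) * (x - p) →
      ∃ y' z' m k, [x, y', z'].Perm l ∧ m * (x - p) = -e ∧ k = e - m * p ∧
      m * x + k = 0 ∧ m * y' + k = 1 ∧ m * z' + k = 3 * e - 1 := by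
    intro y z h1 h2 h3
    refine ⟨y, z, -e / (x - p), e - -e / (x - p) * p, h1, by field_simp, rfl, ?_, ?_, ?_⟩
    · field_simp; ring
    · field_simp; linear_combination -h3
    · field_simp; linear_combination -e * h2 + h3
  have : (e * (y - p) - (e - 1) * (x - p)) * (e * (z - p) - (e - 1) * (x - p)) = 0 := by
    linear_combination (e ^ 2) * hpair
      - (e ^ 2 + e * (e - 1)) * (x - p) * hsum + (3 * hp) * (x - p) ^ 2
  rcases mul_eq_zero.1 this with h | h
  · exact main y z hperm hsum (sub_eq_zero.1 h)
  · exact main z y (((List.Perm.swap y z []).cons x).trans hperm) (by rw [← hsum]; ring) (sub_eq_zero.1 h)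

lemma isOfType_equianharmonic (hperm : [x, y, z].Perm [0, 1, H.d]) (hq : H.q = H.α * H.β * p)
    (hsum : x + y + z = 3 * p)
    (hpair : (x - p) * (y - p) + (y - p) * (z - p) + (z - p) * (x - p) = 0)
    (hA : A * (x - p) ^ 3 = 1) (hR : ∀ t, R.eval t = A * (t - p) ^ 3)
    {g : ℂ} (hexp : ∀ t ∈ [x, y, z], H.exponentAt t = g) : IsOfType equianharmonic H R := by
  have hx : x - p ≠ 0 := by rintro h; simp [h] at hA
  have hA' : A = 1 / (x - p) ^ 3 := by field_simp; exact hA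
  obtain ⟨y', z', m, k, hl, hm, hk, h1, h2, h3⟩ := exists_equianharmonic_affine hperm hx hsum hpair
  have hp0 : equianharmonic.p ≠ 0 := by
    intro h
    have := equianharmonic_p_eq
    norm_num [h] at this
  have hm0 : m ≠ 0 := by
    rintro rfl
    exact hp0 (by linear_combination hm)
  have hg : ∀ t ∈ [x, y', z'], H.exponentAt t = g := fun t ht =>
    hexp t ((hl.trans hperm.symm).mem_iff.1 ht)
  refine isOfType_of_perm (m := m) (k := k) (p := p) hl hm0 h1 h2 h3 (by rw [hk]; ring) hq ?_
    (Or.inl fun t => ?_)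
  · simp only [ReductionType.exponentCondition]
    rw [hg x (by simp), hg y' (by simp), hg z' (by simp)]
    simp
  · simp only [ReductionType.poly, hR, hA', eval_mul, eval_sub, eval_X, eval_one, eval_pow, eval_C]
    have : 1 - 1 / equianharmonic.p * (m * t + k) = (t - p) / (x - p) := by
      field_simp
      rw [hk]
      linear_combination (p - t) * hm
    rw [this]
    field_simp

lemma isOfType_specialEquianharmonic (hperm : [x, y, z].Perm [0, 1, H.d])
    (hq : H.q = H.α * H.β * p) (hsum : x + y + z = 3 * p)
    (hpair : (x - p) * (y - p) + (y - p) * (z - p) + (z - p) * (x - p) = 0)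
    (hA : A * (x - p) ^ 6 = -4)
    (hR : ∀ t, R.eval t = A * (t - p) ^ 3 * ((t - x) * (t - y) * (t - z)))
    (hexp : ∀ t ∈ [x, y, z], H.exponentAt t = 2 / 3) : IsOfType specialEquianharmonic H R := by
  have hx : x - p ≠ 0 := by rintro h; norm_num [h] at hA
  have hA' : A = -4 / (x - p) ^ 6 := by rw [eq_div_iff (by positivity)]; exact hA
  obtain ⟨y', z', m, k, hl, hm, hk, h1, h2, h3⟩ := exists_equianharmonic_affine hperm hx hsum hpair
  have hp0 : equianharmonic.p ≠ 0 := by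
    intro h
    have := equianharmonic_p_eq
    norm_num [h] at this
  have hm0 : m ≠ 0 := by
    rintro rfl
    exact hp0 (by linear_combination hm)
  have hg : ∀ t ∈ [x, y', z'], H.exponentAt t = 2 / 3 := fun t ht =>
    hexp t ((hl.trans hperm.symm).mem_iff.1 ht)
  refine isOfType_of_perm (m := m) (k := k) (p := p) hl hm0 h1 h2 h3
    (show _ = equianharmonic.p by rw [hk]; ring) hq ?_ (Or.inr fun t => ?_)
  · simp only [ReductionType.exponentCondition]
    rw [hg x (by simp), hg y' (by simp), hg z' (by simp)]
    simp
  · have h4 : (t - x) * (t - y) * (t - z) = (t - p) ^ 3 - (x - p) ^ 3 := by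
      linear_combination (t - x) * hpair - ((t - p) ^ 2 - (x - p) ^ 2) * hsum
    simp only [ReductionType.poly, hR, hA', h4, eval_mul, eval_sub, eval_X, eval_one, eval_pow,
      eval_C, eval_ofNat]
    have : 1 - 1 / specialEquianharmonic.p * (m * t + k) = (t - p) / (x - p) := by
      change 1 - 1 / equianharmonic.p * (m * t + k) = _
      field_simp
      rw [hk]
      linear_combination (p - t) * hm
    rw [this]
    field_simp
    ring

lemma isOfType_quartic (hperm : [x, y, z].Perm [0, 1, H.d]) (hq : H.q = H.α * H.β * p)
    (hsum : 2 * ((y - p) + (z - p)) = -(x - p))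
    (hprod : 16 * ((y - p) * (z - p)) = 3 * (x - p) ^ 2)
    (hA : A * (x - p) ^ 4 = -256 / 27) (hR : ∀ t, R.eval t = A * (t - p) ^ 3 * (t - x))
    (hx23 : H.exponentAt x = 2 / 3) (hy12 : H.exponentAt y = 1 / 2)
    (hz12 : H.exponentAt z = 1 / 2) : IsOfType quartic H R := by
  have hx : x - p ≠ 0 := by rintro h; norm_num [h] at hA
  have hp := quartic_p_eq
  have hD := quartic_D_eq
  have hp0 : quartic.p ≠ 0 := by intro h; norm_num [h] at hp
  have hD0 : quartic.D ≠ 0 := by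
    rw [hD]; intro h
    have : (27 : ℂ) / 8 = 0 := by linear_combination 25 * hp + (-5 * quartic.p + 3) * h
    norm_num at this
  have hm0 : 4 * quartic.p - 2 ≠ 0 := by
    intro h
    have : (2 : ℂ) = 0 := by linear_combination 16 * hp - (4 * quartic.p - 2) * h
    norm_num at this
  have main : ∀ y z : ℂ, [x, y, z].Perm [0, 1, H.d] → 2 * ((y - p) + (z - p)) = -(x - p) →
      (4 * quartic.p - 2) * (y - p) + quartic.p * (x - p) = 0 →
      H.exponentAt y = 1 / 2 → H.exponentAt z = 1 / 2 → IsOfType quartic H R := by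
    intro y z hl h1 h2 h3 h4
    refine isOfType_of_perm (m := (4 * quartic.p - 2) / (x - p))
      (k := quartic.p - (4 * quartic.p - 2) / (x - p) * p) (p := p) (x₀ := y) (x₁ := z) (x := x)
      (List.Perm.trans (by
        exact ((List.Perm.swap x z []).cons y).trans (List.Perm.swap x y [z])) hl) (by positivity)
      ?_ ?_ ?_ (by ring) hq ⟨h3, h4, hx23⟩ (Or.inl fun t => ?_)
    · field_simp; linear_combination h2
    · field_simp; linear_combination -h2 + (2 * quartic.p - 1) * h1
    · rw [hD]; field_simp; ring
    · simp only [ReductionType.poly, hR, eval_mul, eval_sub, eval_X, eval_one, eval_pow, eval_C]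
      have e1 : 1 - 1 / quartic.p * ((4 * quartic.p - 2) / (x - p) * t +
          (quartic.p - (4 * quartic.p - 2) / (x - p) * p))
          = -(4 * quartic.p - 2) * (t - p) / (x - p) / quartic.p := by field_simp; ring
      have e2 : 1 - 1 / quartic.D * ((4 * quartic.p - 2) / (x - p) * t +
          (quartic.p - (4 * quartic.p - 2) / (x - p) * p))
          = -(4 * quartic.p - 2) * (t - x) / (x - p) / quartic.D := by
        field_simp; rw [hD]; ring
      rw [e1, e2]
      have hA' : A = -256 / 27 / (x - p) ^ 4 := by rw [eq_div_iff (by positivity)]; exact hA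
      have e3 : quartic.D * quartic.p ^ 3 = -27 / 64 := by
        rw [hD]
        linear_combination (5 * quartic.p ^ 2 + 3 * quartic.p + 9 / 8) * hp
      have e4 : (4 * quartic.p - 2) ^ 4 = 4 := by
        linear_combination (256 * quartic.p ^ 2 - 256 * quartic.p + 32) * hp
      have e5 : A = (4 * quartic.p - 2) ^ 4 / (x - p) ^ 4 / (quartic.D * quartic.p ^ 3) := by
        rw [e3, e4, hA']; ring
      rw [e5]
      field_simp
  have : ((4 * quartic.p - 2) * (y - p) + quartic.p * (x - p)) *
      ((4 * quartic.p - 2) * (z - p) + quartic.p * (x - p)) = 0 := by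
    linear_combination (4 * quartic.p - 2) ^ 2 / 16 * hprod
      + (4 * quartic.p - 2) * quartic.p * (x - p) / 2 * hsum + 2 * (x - p) ^ 2 * hp
  rcases mul_eq_zero.1 this with h | h
  · exact main y z hperm hsum h hy12 hz12
  · exact main z y (((List.Perm.swap y z []).cons x).trans hperm) (by linear_combination hsum) h
      hz12 hy12

lemma isOfType_quintic (hperm : [x, y, z].Perm [0, 1, H.d]) (hq : H.q = H.α * H.β * p)
    (hsum : 3 * ((x - p) + (y - p)) = -5 * (z - p))
    (hprod : 9 * ((x - p) * (y - p)) = 40 * (z - p) ^ 2)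
    (hA : A * (z - p) ^ 5 = 9 / 64) (hR : ∀ t, R.eval t = A * (t - p) ^ 3 * (t - x) * (t - y))
    (hx23 : H.exponentAt x = 2 / 3) (hy23 : H.exponentAt y = 2 / 3)
    (hz12 : H.exponentAt z = 1 / 2) : IsOfType quintic H R := by
  have hz : z - p ≠ 0 := by rintro h; norm_num [h] at hA
  have hp := quintic_p_eq
  have hD := quintic_D_eq
  have hm0 : (6 * quintic.p - 3) / 5 ≠ 0 := by
    intro h
    have : (5 : ℂ) / 27 = 0 := by linear_combination 4 * hp - (10 * quintic.p - 5) / 3 * h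
    norm_num at this
  have main : ∀ x y : ℂ, [x, y, z].Perm [0, 1, H.d] → 3 * ((x - p) + (y - p)) = -5 * (z - p) →
      (6 * quintic.p - 3) / 5 * (x - p) + quintic.p * (z - p) = 0 →
      (∀ t, R.eval t = A * (t - p) ^ 3 * (t - x) * (t - y)) →
      H.exponentAt x = 2 / 3 → H.exponentAt y = 2 / 3 → IsOfType quintic H R := by
    intro x y hl h1 h2 hR h3 h4
    have hx : (6 * quintic.p - 3) / 5 / (z - p) * x
        + (quintic.p - (6 * quintic.p - 3) / 5 / (z - p) * p) = 0 := by
      field_simp; linear_combination 5 * h2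
    have hy : (6 * quintic.p - 3) / 5 / (z - p) * y
        + (quintic.p - (6 * quintic.p - 3) / 5 / (z - p) * p) = 1 := by
      field_simp; linear_combination -5 * h2 + (2 * quintic.p - 1) * h1
    refine isOfType_of_perm (m := (6 * quintic.p - 3) / 5 / (z - p))
      (k := quintic.p - (6 * quintic.p - 3) / 5 / (z - p) * p) (p := p)
      hl (by positivity) hx hy ?_ (by ring) hq ⟨h3, h4, hz12⟩ (Or.inl fun t => ?_)
    · rw [hD]; field_simp; ring
    · simp only [ReductionType.poly, hR, eval_mul, eval_sub, eval_X, eval_one, eval_pow, eval_C]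
      rw [quintic_const_eq]
      set m := (6 * quintic.p - 3) / 5 / (z - p) with hm
      have e1 : m * t + (quintic.p - m * p) = m * (t - x) := by linear_combination hx
      have e2 : m * t + (quintic.p - m * p) - 1 = m * (t - y) := by linear_combination hy
      have e3 : m * t + (quintic.p - m * p) - quintic.p = m * (t - p) := by ring
      rw [e2, e3, e1]
      have e4 : A = -(18225 / 32) * (quintic.p - 1 / 2) * m ^ 5 := by
        have hA' : A = 9 / 64 / (z - p) ^ 5 := by rw [eq_div_iff (by positivity)]; exact hA
        have e5 : (quintic.p - 1 / 2) ^ 6 = (-5 / 108) ^ 3 := by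
          have : (quintic.p - 1 / 2) ^ 2 = -5 / 108 := by linear_combination hp
          rw [← this]; ring
        rw [hA', hm]
        field_simp
        linear_combination (18139852800 : ℂ) * e5
      rw [e4]; ring
  have : ((6 * quintic.p - 3) / 5 * (x - p) + quintic.p * (z - p)) *
      ((6 * quintic.p - 3) / 5 * (y - p) + quintic.p * (z - p)) = 0 := by
    linear_combination ((6 * quintic.p - 3) / 5) ^ 2 / 9 * hprod
      + (6 * quintic.p - 3) / 5 * quintic.p * (z - p) / 3 * hsum + 27 / 5 * (z - p) ^ 2 * hp
  rcases mul_eq_zero.1 this with h | h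
  · exact main x y hperm hsum h hR hx23 hy23
  · exact main y x ((List.Perm.swap x y [z]).trans hperm) (by linear_combination hsum) h
      (fun t => by rw [hR]; ring) hy23 hx23

end HeunReduction

namespace HeunReduction

open ReductionType

lemma IsHlReduction.of_transforms {H : HeunEquation} {a b c : ℂ} {P : ℂ[X]}
    (hT : Transforms H a b c (algebraMap ℂ[X] (RatFunc ℂ) P)) (hd : H.d ≠ 0)
    (hγ : NotNonposInt H.γ) (hc : NotNonposInt c) (hP0 : P.eval 0 = 0) :
    IsHlReduction H a b c (algebraMap ℂ[X] (RatFunc ℂ) P) where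
  transforms := hT
  gamma_ok := hγ
  c_ok := hc
  map_zero := by rwa [RatFunc.num_algebraMap]
  identity := by
    rw [ratEval_algebraMap]
    exact Hl_eq_hypergeometric_comp hT hd hγ hc hP0

lemma HeunEquation.exponentAt_zero (H : HeunEquation) : H.exponentAt 0 = H.γ := by
  simp [exponentAt]

lemma HeunEquation.exponentAt_one (H : HeunEquation) : H.exponentAt 1 = H.δ := by
  simp [exponentAt]

lemma HeunEquation.exponentAt_d {H : HeunEquation} (h0 : H.d ≠ 0) (h1 : H.d ≠ 1) :
    H.exponentAt H.d = H.ε := by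
  simp [exponentAt, h0, h1]

lemma notNonposInt_of_re_pos {x : ℂ} (h : 0 < x.re) : NotNonposInt x := by
  rintro n rfl
  have : (0 : ℝ) ≤ n := n.cast_nonneg
  simp at h
  linarith

lemma notNonposInt_half : NotNonposInt (1 / 2) := notNonposInt_of_re_pos (by norm_num)

lemma notNonposInt_two_thirds : NotNonposInt (2 / 3) := notNonposInt_of_re_pos (by norm_num)

lemma isHlReductionOfType_harmonic {α β γ : ℂ} (hγ : NotNonposInt γ) :
    IsHlReductionOfType .harmonic ⟨2, α * β, α, β, γ, α + β - 2 * γ + 1⟩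
      (α / 2) (β / 2) γ (X * (2 - X)) := by
  refine ⟨.of_transforms (transforms_of_factors (K₀ := -1) (K₁ := -1) (K₂ := -2) (M₀ := {0, 2})
    (M₁ := {1, 1}) (M₂ := {1}) (by norm_num) ?_ ?_ ?_ ?_ ?_) (by norm_num) hγ hγ (by simp), ?_⟩
  · refine Polynomial.funext fun t => ?_
    simp [-mul_eq_mul_left_iff, -mul_eq_mul_right_iff, -neg_inj]
    ring
  · refine Polynomial.funext fun t => ?_
    simp [-mul_eq_mul_left_iff, -mul_eq_mul_right_iff, -neg_inj]
    ring
  · refine Polynomial.funext fun t => ?_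
    simp [-mul_eq_mul_left_iff, -mul_eq_mul_right_iff, -neg_inj]
    ring
  · intro t
    simp [coeffP, ε]; ring
  · intro t
    simp [-mul_eq_mul_left_iff, -mul_eq_mul_right_iff, -neg_inj]
    ring
  · refine isOfType_harmonic (y := 0) (p := 1) (z := 2) (A := 1) (List.Perm.refl _) (by simp) ?_ ?_
      (fun t => ?_) ?_ |>.one_sub
    · norm_num
    · norm_num
    · simp; ring
    · have := HeunEquation.exponentAt_d (H := ⟨2, α * β, α, β, γ, α + β - 2 * γ + 1⟩)
        (by norm_num) (by norm_num)
      refine (HeunEquation.exponentAt_zero _).trans (Eq.trans ?_ this.symm)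
      simp only [ε]; ring

lemma isHlReductionOfType_realCubic (α β : ℂ) :
    IsHlReductionOfType .realCubic ⟨4, α * β, α, β, 1 / 2, 2 * (α + β) / 3⟩
      (α / 3) (β / 3) (1 / 2) (1 - (X - 1) ^ 2 * (1 - C (1 / 4) * X)) := by
  refine ⟨.of_transforms (transforms_of_factors (K₀ := 1 / 4) (K₁ := 1 / 4) (K₂ := 3 / 4)
    (M₀ := {0, 3, 3}) (M₁ := {1, 1, 4}) (M₂ := {1, 3}) (by norm_num) ?_ ?_ ?_ ?_ ?_)
    (by norm_num) notNonposInt_half notNonposInt_half (by simp), ?_⟩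
  · refine Polynomial.funext fun t => ?_
    simp [-mul_eq_mul_left_iff, -mul_eq_mul_right_iff, -neg_inj]
    ring
  · refine Polynomial.funext fun t => ?_
    simp [-mul_eq_mul_left_iff, -mul_eq_mul_right_iff, -neg_inj]
    ring
  · refine Polynomial.funext fun t => ?_
    simp [derivative_pow, -mul_eq_mul_left_iff, -mul_eq_mul_right_iff, -neg_inj]
    ring
  · intro t
    simp [coeffP, ε]; ring
  · intro t
    simp [derivative_pow, -mul_eq_mul_left_iff, -mul_eq_mul_right_iff, -neg_inj]
    ring
  · refine isOfType_realCubic (z := 0) (p := 1) (y := 4) (A := -1 / 4) (List.Perm.refl _) (by simp)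
      ?_ ?_ (fun t => ?_) ?_ ?_ |>.one_sub
    · norm_num
    · norm_num
    · simp; ring
    · exact HeunEquation.exponentAt_zero _
    · have := HeunEquation.exponentAt_d (H := ⟨4, α * β, α, β, 1 / 2, 2 * (α + β) / 3⟩)
        (by norm_num) (by norm_num)
      rw [HeunEquation.exponentAt_one]
      refine Eq.trans ?_ (congrArg (fun u => 2 * (1 - u)) this.symm)
      simp only [ε]; ring

lemma isHlReductionOfType_specialHarmonic {α β : ℂ} (hγ : NotNonposInt ((α + β + 2) / 4)) :
    IsHlReductionOfType .specialHarmonic ⟨2, α * β, α, β, (α + β + 2) / 4, (α + β) / 2⟩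
      (α / 4) (β / 4) ((α + β + 2) / 4) (1 - 4 * (X * (2 - X) - C (1 / 2)) ^ 2) := by
  obtain ⟨r, hr⟩ : ∃ r : ℂ, r ^ 2 = 1 / 2 := IsAlgClosed.exists_pow_nat_eq _ (by norm_num)
  refine ⟨.of_transforms (transforms_of_factors (K₀ := -4) (K₁ := -4) (K₂ := -16)
    (M₀ := {0, 2, 1, 1}) (M₁ := {1 + r, 1 + r, 1 - r, 1 - r}) (M₂ := {1, 1 + r, 1 - r})
    (by norm_num) ?_ ?_ ?_ ?_ ?_) (by norm_num) hγ hγ (by simp; norm_num), ?_⟩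
  · refine Polynomial.funext fun t => ?_
    simp [-mul_eq_mul_left_iff, -mul_eq_mul_right_iff, -neg_inj]
    ring
  · refine Polynomial.funext fun t => ?_
    have : (t - (1 + r)) * (t - (1 - r)) = (t - 1) ^ 2 - 1 / 2 := by linear_combination -hr
    simp [-mul_eq_mul_left_iff, -mul_eq_mul_right_iff, -neg_inj]
    linear_combination 4 * ((t - (1 + r)) * (t - (1 - r)) + (t - 1) ^ 2 - 1 / 2) * this
  · refine Polynomial.funext fun t => ?_
    have : (t - (1 + r)) * (t - (1 - r)) = (t - 1) ^ 2 - 1 / 2 := by linear_combination -hr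
    simp [derivative_pow, -mul_eq_mul_left_iff, -mul_eq_mul_right_iff, -neg_inj]
    linear_combination 16 * (t - 1) * this
  · intro t
    simp [coeffP, ε]; ring
  · intro t
    simp [derivative_pow, -mul_eq_mul_left_iff, -mul_eq_mul_right_iff, -neg_inj]
    ring
  · refine isOfType_specialHarmonic (y := 0) (p := 1) (z := 2) (A := -4) (List.Perm.refl _)
      (by simp) ?_ ?_ (fun t => ?_) ?_ ?_
    · norm_num
    · norm_num
    · simp; ring
    · have := HeunEquation.exponentAt_d
        (H := ⟨2, α * β, α, β, (α + β + 2) / 4, (α + β) / 2⟩) (by norm_num) (by norm_num)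
      refine (HeunEquation.exponentAt_zero _).trans (Eq.trans ?_ this.symm)
      simp only [ε]; ring
    · rw [HeunEquation.exponentAt_zero, HeunEquation.exponentAt_one]
      ring

lemma isHlReductionOfType_equianharmonic {α β p : ℂ} (hp : p ^ 2 - p + 1 / 3 = 0)
    (hγ : NotNonposInt ((α + β + 1) / 3)) :
    IsHlReductionOfType .equianharmonic
      ⟨3 * p - 1, α * β * p, α, β, (α + β + 1) / 3, (α + β + 1) / 3⟩
      (α / 3) (β / 3) ((α + β + 1) / 3) (1 - (1 - C (1 / p) * X) ^ 3) := by
  have hp0 : p ≠ 0 := by rintro rfl; norm_num at hp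
  have hd0 : 3 * p - 1 ≠ 0 := by
    intro h
    have : (1 : ℂ) = 0 := by linear_combination 9 * hp - (3 * p - 2) * h
    norm_num at this
  have hd1 : 3 * p - 1 ≠ 1 := by
    intro h
    have : (1 : ℂ) = 0 := by linear_combination 9 * hp - (3 * p - 1) * h
    norm_num at this
  have hP : ∀ t, (1 - 1 / p * t) ^ 3 = -1 / p ^ 3 * (t - p) ^ 3 := by
    intro t; field_simp; ring
  have hf : ∀ t, 1 - (1 - 1 / p * t) ^ 3 = 1 / p ^ 3 * (t * (t - 1) * (t - (3 * p - 1))) := by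
    intro t; field_simp; linear_combination 3 * t * hp
  refine ⟨.of_transforms (transforms_of_factors (K₀ := 1 / p ^ 3) (K₁ := 1 / p ^ 3)
    (K₂ := 3 / p ^ 3) (M₀ := {0, 1, 3 * p - 1}) (M₁ := {p, p, p}) (M₂ := {p, p})
    (div_ne_zero (by norm_num) (pow_ne_zero _ hp0)) ?_ ?_ ?_ ?_ ?_) hd0 hγ hγ (by simp), ?_⟩
  · refine Polynomial.funext fun t => ?_
    have := hf t
    simp at this ⊢
    linear_combination this
  · refine Polynomial.funext fun t => ?_
    have := hP t
    simp at this ⊢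
    linear_combination -this
  · refine Polynomial.funext fun t => ?_
    simp [derivative_pow, -mul_eq_mul_left_iff, -mul_eq_mul_right_iff, -neg_inj]
    field_simp; ring
  · intro t
    simp [coeffP, ε]; ring
  · intro t
    have e1 : (1 - (1 - C (1 / p) * X) ^ 3 : ℂ[X]).eval t
        = 1 / p ^ 3 * (t * (t - 1) * (t - (3 * p - 1))) := by rw [← hf]; simp
    have e2 : (1 - (1 - C (1 / p) * X) ^ 3 : ℂ[X]).eval t - 1 = 1 / p ^ 3 * (t - p) ^ 3 := by
      have := hP t
      simp at this ⊢
      linear_combination -this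
    have e3 : (derivative (1 - (1 - C (1 / p) * X) ^ 3 : ℂ[X])).eval t
        = 3 / p ^ 3 * (t - p) ^ 2 := by
      simp [derivative_pow, -mul_eq_mul_left_iff, -mul_eq_mul_right_iff, -neg_inj]
      field_simp; ring
    rw [e2, e1, e3]; ring
  · refine isOfType_equianharmonic (x := 0) (y := 1) (z := 3 * p - 1) (p := p) (A := -1 / p ^ 3)
      (g := (α + β + 1) / 3) (List.Perm.refl _) rfl ?_ ?_ ?_ (fun t => ?_) ?_ |>.one_sub
    · ring
    · linear_combination (-3) * hp
    · field_simp; ring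
    · rw [← hP]; simp
    · have := HeunEquation.exponentAt_d
        (H := ⟨3 * p - 1, α * β * p, α, β, (α + β + 1) / 3, (α + β + 1) / 3⟩) hd0 hd1
      intro t ht
      simp only [List.mem_cons, List.not_mem_nil, or_false] at ht
      rcases ht with rfl | rfl | rfl
      · exact HeunEquation.exponentAt_zero _
      · exact HeunEquation.exponentAt_one _
      · refine this.trans ?_
        simp only [ε]; ring

lemma isHlReductionOfType_quartic {α p : ℂ} (hp : p ^ 2 - p + 3 / 8 = 0) :
    IsHlReductionOfType .quartic
      ⟨5 * p - 2, α * (2 / 3 - α) * p, α, 2 / 3 - α, 1 / 2, 1 / 2⟩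
      (α / 4) (1 / 6 - α / 4) (1 / 2)
      (1 - (1 - C (1 / (5 * p - 2)) * X) * (1 - C (1 / p) * X) ^ 3) := by
  have hp0 : p ≠ 0 := by rintro rfl; norm_num at hp
  have hd0 : 5 * p - 2 ≠ 0 := by
    intro h
    have : (27 : ℂ) / 8 = 0 := by linear_combination 25 * hp - (5 * p - 3) * h
    norm_num at this
  have hd1 : 5 * p - 2 ≠ 1 := by
    intro h
    have : (27 : ℂ) / 8 = 0 := by linear_combination 25 * hp - (5 * p - 2) * h
    norm_num at this
  have hK : (5 * p - 2) * p ^ 3 = -27 / 64 := by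
    linear_combination (5 * p ^ 2 + 3 * p + 9 / 8) * hp
  have hP : ∀ t, (1 - 1 / (5 * p - 2) * t) * (1 - 1 / p * t) ^ 3
      = -64 / 27 * ((t - (5 * p - 2)) * (t - p) ^ 3) := by
    intro t
    have e : (-64 / 27 : ℂ) = 1 / ((5 * p - 2) * p ^ 3) := by rw [hK]; norm_num
    rw [e]; field_simp; ring
  have hf : ∀ t, 1 + 64 / 27 * ((t - (5 * p - 2)) * (t - p) ^ 3)
      = 64 / 27 * (t * (t - 1) * (t - (4 * p - 3 / 2)) ^ 2) := by
    intro t; grind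
  set d := 5 * p - 2 with hd
  have e0 : (1 - (1 - C (1 / d) * X) * (1 - C (1 / p) * X) ^ 3 : ℂ[X])
      = 1 + C (64 / 27) * ((X - C d) * (X - C p) ^ 3) := by
    refine Polynomial.funext fun t => ?_
    have := hP t
    simp at this ⊢
    linear_combination -this
  have e3 : ∀ t, (derivative (1 + C (64 / 27) * ((X - C d) * (X - C p) ^ 3) : ℂ[X])).eval t
        = 256 / 27 * ((t - p) ^ 2 * (t - (4 * p - 3 / 2))) := by
    intro t
    simp [derivative_pow, -mul_eq_mul_left_iff, -mul_eq_mul_right_iff, -neg_inj]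
    rw [hd]; ring
  rw [e0]
  refine ⟨.of_transforms (transforms_of_factors (K₀ := 64 / 27) (K₁ := 64 / 27)
    (K₂ := 256 / 27) (M₀ := {0, 1, 4 * p - 3 / 2, 4 * p - 3 / 2}) (M₁ := {d, p, p, p})
    (M₂ := {p, p, 4 * p - 3 / 2})
    (by norm_num) ?_ ?_ ?_ ?_ ?_) hd0 notNonposInt_half notNonposInt_half ?_, ?_⟩
  · refine Polynomial.funext fun t => ?_
    have := hf t
    simp at this ⊢
    linear_combination this
  · refine Polynomial.funext fun t => ?_
    simp [-mul_eq_mul_left_iff, -mul_eq_mul_right_iff, -neg_inj]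
    ring
  · refine Polynomial.funext fun t => ?_
    rw [e3]
    simp [-mul_eq_mul_left_iff, -mul_eq_mul_right_iff, -neg_inj]
    ring
  · intro t
    simp [coeffP, ε]; ring
  · intro t
    have e1 : (1 + C (64 / 27) * ((X - C d) * (X - C p) ^ 3) : ℂ[X]).eval t
        = 64 / 27 * (t * (t - 1) * (t - (4 * p - 3 / 2)) ^ 2) := by rw [← hf]; simp
    have e2 : (1 + C (64 / 27) * ((X - C d) * (X - C p) ^ 3) : ℂ[X]).eval t - 1
        = 64 / 27 * ((t - d) * (t - p) ^ 3) := by simp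
    rw [e2, e1, e3]; ring
  · have := hf 0
    simp at this ⊢
    linear_combination this
  · refine isOfType_quartic (x := d) (y := 0) (z := 1) (p := p) (A := -64 / 27)
      ?_ rfl ?_ ?_ ?_ (fun t => ?_) ?_ ?_ ?_ |>.one_sub
    · exact (List.Perm.swap 0 d [1]).trans ((List.Perm.swap 1 d []).cons 0)
    · rw [hd]; ring
    · rw [hd]; linear_combination (-32) * hp
    · rw [hd]
      linear_combination (-64 / 27) * (256 * p ^ 2 - 256 * p + 32) * hp
    · simp; ring
    · refine (HeunEquation.exponentAt_d
        (H := ⟨d, α * (2 / 3 - α) * p, α, 2 / 3 - α, 1 / 2, 1 / 2⟩) hd0 hd1).trans ?_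
      simp only [ε]; ring
    · exact HeunEquation.exponentAt_zero _
    · exact HeunEquation.exponentAt_one _

lemma isHlReductionOfType_quintic {α p : ℂ} (hp : p ^ 2 - p + 8 / 27 = 0) :
    IsHlReductionOfType .quintic
      ⟨11 / 5 * p - 3 / 5, α * (5 / 6 - α) * p, α, 5 / 6 - α, 2 / 3, 2 / 3⟩
      (α / 5) (1 / 6 - α / 5) (2 / 3)
      (C (-(18225 / 32) * (p - 1 / 2)) * X * (X - 1) * (X - C p) ^ 3) := by
  obtain ⟨r, hr⟩ : ∃ r : ℂ, r ^ 2 = 16 / 27 := IsAlgClosed.exists_pow_nat_eq _ (by norm_num)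
  have hd0 : 11 / 5 * p - 3 / 5 ≠ 0 := by
    intro h
    have : (64 : ℂ) / 135 = 0 := by linear_combination 121 / 25 * hp - (11 / 5 * p - 8 / 5) * h
    norm_num at this
  have hd1 : 11 / 5 * p - 3 / 5 ≠ 1 := by
    intro h
    have : (64 : ℂ) / 135 = 0 := by linear_combination 121 / 25 * hp - (11 / 5 * p - 3 / 5) * h
    norm_num at this
  set K := -(18225 / 32) * (p - 1 / 2) with hK
  have hK0 : K ≠ 0 := by
    intro h
    have : (p - 1 / 2) ^ 2 = -5 / 108 := by linear_combination hp
    have h2 : p - 1 / 2 = 0 := by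
      rw [hK] at h
      exact (mul_eq_zero.1 h).resolve_left (by norm_num)
    norm_num [h2] at this
  set d := 11 / 5 * p - 3 / 5 with hd
  obtain ⟨w₁, w₂, hw⟩ : ∃ w₁ w₂ : ℂ, ∀ t, (t - w₁) * (t - w₂)
      = (t - p) ^ 2 + 4 / 3 * (d - p) * (t - p) + 8 / 3 * (d - p) ^ 2 := by
    refine ⟨p - 2 / 3 * (d - p) + r / 2, p - 2 / 3 * (d - p) - r / 2, fun t => ?_⟩
    have : (d - p) ^ 2 = -1 / 15 := by rw [hd]; linear_combination 36 / 25 * hp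
    linear_combination -1 / 4 * hr - 20 / 9 * this
  have hf : ∀ t, K * t * (t - 1) * (t - p) ^ 3 - 1
      = K * ((t - d) * ((t - w₁) * (t - w₂)) ^ 2) := by
    intro t
    have e1 : (p - 1 / 2) ^ 6 = (-5 / 108) ^ 3 := by
      have : (p - 1 / 2) ^ 2 = -5 / 108 := by linear_combination hp
      rw [← this]; ring
    have e2 : t * (t - 1) = (t - p) ^ 2 + 5 / 3 * (d - p) * (t - p) + 40 / 9 * (d - p) ^ 2 := by
      rw [hd]; linear_combination (-27 / 5) * hp
    have e3 : K * (64 / 9 * (d - p) ^ 5) = 1 := by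
      rw [hK, hd]; linear_combination -(18225 / 32) * (64 / 9) * (6 / 5) ^ 5 * e1
    have e4 : t - d = (t - p) - (d - p) := by ring
    rw [hw, mul_assoc K, e2, e4, ← e3]
    ring
  have e1 : ∀ t, (C K * X * (X - 1) * (X - C p) ^ 3 : ℂ[X]).eval t
      = K * t * (t - 1) * (t - p) ^ 3 := by intro t; simp
  have e3 : ∀ t, (derivative (C K * X * (X - 1) * (X - C p) ^ 3 : ℂ[X])).eval t
      = 5 * K * ((t - p) ^ 2 * ((t - w₁) * (t - w₂))) := by
    intro t
    rw [hw, hd]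
    simp [derivative_pow, -mul_eq_mul_left_iff, -mul_eq_mul_right_iff, -neg_inj]
    linear_combination K * (t - p) ^ 2 * (-81 / 5) * hp
  refine ⟨.of_transforms (transforms_of_factors (K₀ := K) (K₁ := K)
    (K₂ := 5 * K) (M₀ := {0, 1, p, p, p}) (M₁ := {d, w₁, w₁, w₂, w₂})
    (M₂ := {p, p, w₁, w₂})
    (mul_ne_zero (by norm_num) hK0) ?_ ?_ ?_ ?_ ?_) hd0 notNonposInt_two_thirds notNonposInt_two_thirds ?_, ?_⟩
  · refine Polynomial.funext fun t => ?_
    simp [-mul_eq_mul_left_iff, -mul_eq_mul_right_iff, -neg_inj]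
    ring
  · refine Polynomial.funext fun t => ?_
    have := hf t
    simp at this ⊢
    linear_combination this
  · refine Polynomial.funext fun t => ?_
    rw [e3]
    simp [-mul_eq_mul_left_iff, -mul_eq_mul_right_iff, -neg_inj]
    ring
  · intro t
    simp [coeffP, ε]; ring
  · intro t
    rw [e3, e1, hf]; ring
  · simp
  · refine isOfType_quintic (x := 0) (y := 1) (z := d) (p := p) (A := K)
      (List.Perm.refl _) rfl ?_ ?_ ?_ (fun t => ?_) ?_ ?_ ?_
    · rw [hd]; ring
    · rw [hd]; linear_combination (-243 / 5) * hp
    · have e5 : (p - 1 / 2) ^ 6 = (-5 / 108) ^ 3 := by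
        have : (p - 1 / 2) ^ 2 = -5 / 108 := by linear_combination hp
        rw [← this]; ring
      rw [hK, hd]
      linear_combination -(18225 / 32) * (6 / 5) ^ 5 * e5
    · simp; ring
    · exact HeunEquation.exponentAt_zero _
    · exact HeunEquation.exponentAt_one _
    · refine (HeunEquation.exponentAt_d
        (H := ⟨d, α * (5 / 6 - α) * p, α, 5 / 6 - α, 2 / 3, 2 / 3⟩) hd0 hd1).trans ?_
      simp only [ε]; ring

lemma isHlReductionOfType_specialEquianharmonic {α p : ℂ} (hp : p ^ 2 - p + 1 / 3 = 0) :
    IsHlReductionOfType .specialEquianharmonic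
      ⟨3 * p - 1, α * (1 - α) * p, α, 1 - α, 2 / 3, 2 / 3⟩
      (α / 6) (1 / 6 - α / 6) (2 / 3)
      (1 - 4 * ((1 - C (1 / p) * X) ^ 3 - C (1 / 2)) ^ 2) := by
  obtain ⟨r, hr⟩ : ∃ r : ℂ, r ^ 3 = 1 / 2 := IsAlgClosed.exists_pow_nat_eq _ (by norm_num)
  have hp0 : p ≠ 0 := by rintro rfl; norm_num at hp
  have hd0 : 3 * p - 1 ≠ 0 := by
    intro h
    have : (1 : ℂ) = 0 := by linear_combination 9 * hp - (3 * p - 2) * h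
    norm_num at this
  have hd1 : 3 * p - 1 ≠ 1 := by
    intro h
    have : (1 : ℂ) = 0 := by linear_combination 9 * hp - (3 * p - 1) * h
    norm_num at this
  have hp6 : p ^ 6 = -1 / 27 := by
    linear_combination (p ^ 4 + p ^ 3 + 2 / 3 * p ^ 2 + 1 / 3 * p + 1 / 9) * hp
  have hP : ∀ t, (1 - 1 / p * t) ^ 3 = 27 * p ^ 3 * (t - p) ^ 3 := by
    intro t
    have : 27 * p ^ 3 = -1 / p ^ 3 := by field_simp; linear_combination 27 * hp6
    rw [this]; field_simp; ring
  have hf' : ∀ t : ℂ, (t - p) ^ 3 + p ^ 3 = t * (t - 1) * (t - (3 * p - 1)) := by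
    intro t; linear_combination 3 * t * hp
  set d := 3 * p - 1 with hd
  obtain ⟨w₁, w₂, w₃, hw⟩ : ∃ w₁ w₂ w₃ : ℂ, ∀ t, (t - w₁) * (t - w₂) * (t - w₃)
      = (t - p) ^ 3 + p ^ 3 / 2 := by
    refine ⟨p - p * r, p - p * r * (3 * p - 2), p - p * r * (1 - 3 * p), fun t => ?_⟩
    have e1 : (t - (p - p * r * (3 * p - 2))) * (t - (p - p * r * (1 - 3 * p)))
      = (t - p) ^ 2 - (t - p) * (p * r) + (p * r) ^ 2 := by
      linear_combination (-9 * (p * r) ^ 2) * hp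
    rw [mul_assoc, e1]
    linear_combination p ^ 3 * hr
  have e0 : (1 - 4 * ((1 - C (1 / p) * X) ^ 3 - C (1 / 2)) ^ 2 : ℂ[X])
      = C 108 * ((X - C p) ^ 3 * ((X - C p) ^ 3 + C (p ^ 3))) := by
    refine Polynomial.funext fun t => ?_
    have := hP t
    simp only [eval_sub, eval_one, eval_mul, eval_pow, eval_C, eval_X, eval_ofNat, eval_add, this]
    linear_combination -4 * 27 ^ 2 * (t - p) ^ 6 * hp6
  have e1 : ∀ t, (C 108 * ((X - C p) ^ 3 * ((X - C p) ^ 3 + C (p ^ 3))) : ℂ[X]).eval t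
      = 108 * ((t - p) ^ 3 * (t * (t - 1) * (t - d))) := by
    intro t; rw [← hf']; simp
  have e2 : ∀ t, (C 108 * ((X - C p) ^ 3 * ((X - C p) ^ 3 + C (p ^ 3))) : ℂ[X]).eval t - 1
      = 108 * ((t - w₁) * (t - w₂) * (t - w₃)) ^ 2 := by
    intro t
    rw [hw]; simp
    linear_combination -27 * hp6
  have e3 : ∀ t, (derivative (C 108 * ((X - C p) ^ 3 * ((X - C p) ^ 3 + C (p ^ 3))) : ℂ[X])).eval t
      = 648 * ((t - p) ^ 2 * ((t - w₁) * (t - w₂) * (t - w₃))) := by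
    intro t; rw [hw]
    simp only [derivative_mul, derivative_C, derivative_add, derivative_X_sub_C_pow, eval_add,
      eval_mul, eval_C, eval_pow, eval_sub, eval_X]
    simp
    ring
  rw [e0]
  refine ⟨.of_transforms (transforms_of_factors (K₀ := 108) (K₁ := 108)
    (K₂ := 648) (M₀ := {0, 1, d, p, p, p}) (M₁ := {w₁, w₁, w₂, w₂, w₃, w₃})
    (M₂ := {p, p, w₁, w₂, w₃})
    (by norm_num) ?_ ?_ ?_ ?_ ?_) hd0 notNonposInt_two_thirds notNonposInt_two_thirds ?_, ?_⟩
  · refine Polynomial.funext fun t => ?_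
    rw [e1]
    simp [-mul_eq_mul_left_iff, -mul_eq_mul_right_iff, -neg_inj]
    ring
  · refine Polynomial.funext fun t => ?_
    rw [eval_sub, eval_one, e2]
    simp [-mul_eq_mul_left_iff, -mul_eq_mul_right_iff, -neg_inj]
    ring
  · refine Polynomial.funext fun t => ?_
    rw [e3]
    simp [-mul_eq_mul_left_iff, -mul_eq_mul_right_iff, -neg_inj]
    ring
  · intro t
    simp [coeffP, ε]; ring
  · intro t
    rw [e2, e1, e3]; ring
  · rw [e1]; simp
  · refine isOfType_specialEquianharmonic (x := 0) (y := 1) (z := d) (p := p) (A := 108)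
      (List.Perm.refl _) rfl ?_ ?_ ?_ (fun t => ?_) ?_
    · rw [hd]; ring
    · rw [hd]; linear_combination (-3) * hp
    · linear_combination 108 * hp6
    · rw [e1]; ring
    · intro t ht
      simp only [List.mem_cons, List.not_mem_nil, or_false] at ht
      rcases ht with rfl | rfl | rfl
      · exact HeunEquation.exponentAt_zero _
      · exact HeunEquation.exponentAt_one _
      · refine (HeunEquation.exponentAt_d
          (H := ⟨d, α * (1 - α) * p, α, 1 - α, 2 / 3, 2 / 3⟩) hd0 hd1).trans ?_
        simp only [ε]; ring

end HeunReduction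

namespace HeunReduction

open ReductionType

lemma eq_of_eventually_eval_eq {P Q : ℂ[X]} (h : ∀ᶠ t in cofinite, P.eval t = Q.eval t) :
    P = Q := by
  by_contra hne
  obtain ⟨t, h1, h2⟩ := (h.and (eventually_eval_ne_zero (sub_ne_zero.2 hne))).exists
  exact h2 (by rw [eval_sub, h1, sub_self])

lemma coeffs_eq_zero {p a₀ a₁ a₂ a₃ a₄ a₅ a₆ : ℂ}
    (h : ∀ᶠ t in cofinite, a₀ + a₁ * (t - p) + a₂ * (t - p) ^ 2 + a₃ * (t - p) ^ 3
      + a₄ * (t - p) ^ 4 + a₅ * (t - p) ^ 5 + a₆ * (t - p) ^ 6 = 0) :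
    a₀ = 0 ∧ a₁ = 0 ∧ a₂ = 0 ∧ a₃ = 0 ∧ a₄ = 0 ∧ a₅ = 0 ∧ a₆ = 0 := by
  have h0 : C a₀ + C a₁ * X + C a₂ * X ^ 2 + C a₃ * X ^ 3 + C a₄ * X ^ 4 + C a₅ * X ^ 5
      + C a₆ * X ^ 6 = 0 := by
    have h1 : (C a₀ + C a₁ * X + C a₂ * X ^ 2 + C a₃ * X ^ 3 + C a₄ * X ^ 4 + C a₅ * X ^ 5
      + C a₆ * X ^ 6).comp (X - C p) = 0 := by
      refine eq_of_eventually_eval_eq ?_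
      filter_upwards [h] with t ht
      simpa using ht
    have h2 := congrArg (fun P => P.comp (X + C p)) h1
    simpa [comp_assoc] using h2
  have hc := fun n => congrArg (fun P => coeff P n) h0
  simp only [coeff_add, coeff_C_mul, coeff_X_pow, coeff_C, coeff_X, coeff_zero] at hc
  have c0 := hc 0
  have c1 := hc 1
  have c2 := hc 2
  have c3 := hc 3
  have c4 := hc 4
  have c5 := hc 5
  have c6 := hc 6
  norm_num at c0 c1 c2 c3 c4 c5 c6
  exact ⟨c0, c1, c2, c3, c4, c5, c6⟩

lemma tendsto_sub_mul_logDeriv {f : ℂ[X]} (hf : f ≠ 0) (x : ℂ) :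
    Tendsto (fun t => (t - x) * (f.derivative.eval t / f.eval t)) (𝓝[≠] x)
      (𝓝 (f.rootMultiplicity x)) := by
  obtain ⟨g, hg, hgx⟩ := exists_eq_pow_rootMultiplicity_mul_and_not_dvd f hf x
  rw [dvd_iff_isRoot, IsRoot] at hgx
  set k := f.rootMultiplicity x
  have h1 : Tendsto (fun t => (k : ℂ) + (t - x) * (g.derivative.eval t / g.eval t)) (𝓝[≠] x)
      (𝓝 k) := by
    have : ContinuousAt (fun t => (k : ℂ) + (t - x) * (g.derivative.eval t / g.eval t)) x :=
      continuousAt_const.add ((continuousAt_id.sub continuousAt_const).mul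
        ((g.derivative.continuous.continuousAt).div (g.continuous.continuousAt) hgx))
    have h2 := this.tendsto.mono_left (nhdsWithin_le_nhds (s := {x}ᶜ))
    simpa using h2
  refine h1.congr' ?_
  have hgt : ∀ᶠ t in 𝓝[≠] x, g.eval t ≠ 0 :=
    mem_nhdsWithin_of_mem_nhds (g.continuous.continuousAt.eventually_ne hgx)
  filter_upwards [hgt, self_mem_nhdsWithin] with t h2 h3
  have h3' : t - x ≠ 0 := sub_ne_zero.2 h3
  rw [hg]
  rcases k with _ | k
  · simp
  · simp only [derivative_mul, derivative_X_sub_C_pow, eval_add, eval_mul, eval_pow, eval_sub,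
      eval_X, eval_C, map_natCast, eval_natCast, Nat.add_sub_cancel]
    field_simp
    ring

lemma tendsto_sub_mul_inv (x y : ℂ) :
    Tendsto (fun t => (t - x) * (1 / (t - y))) (𝓝[≠] x) (𝓝 (if x = y then 1 else 0)) := by
  have := tendsto_sub_mul_logDeriv (X_sub_C_ne_zero y) x
  rw [rootMultiplicity_X_sub_C] at this
  simpa using this

lemma HeunEquation.exponentAt_eq {H : HeunEquation} (h0 : H.d ≠ 0) (h1 : H.d ≠ 1) (x : ℂ) :
    H.exponentAt x = H.γ * (if x = 0 then 1 else 0) + H.δ * (if x = 1 then 1 else 0)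
      + H.ε * (if x = H.d then 1 else 0) := by
  unfold exponentAt
  split_ifs with h2 h3 h4 h5 h6 <;> simp_all

lemma HeunEquation.tendsto_sub_mul_coeffP {H : HeunEquation} (h0 : H.d ≠ 0) (h1 : H.d ≠ 1) (x : ℂ) :
    Tendsto (fun t => (t - x) * H.coeffP t) (𝓝[≠] x) (𝓝 (H.exponentAt x)) := by
  rw [HeunEquation.exponentAt_eq h0 h1]
  refine ((((tendsto_sub_mul_inv x 0).const_mul H.γ).add
    ((tendsto_sub_mul_inv x 1).const_mul H.δ)).add
    ((tendsto_sub_mul_inv x H.d).const_mul H.ε)).congr fun t => ?_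
  simp only [coeffP]
  ring

lemma exists_eq_prod_of_rootMultiplicity {R : ℂ[X]} (hR : R ≠ 0) {M : Multiset ℂ} {l : List ℂ}
    (hM : ∀ t ∈ M, t ∈ l) (hoff : ∀ t, t ∉ l → R.rootMultiplicity t = 0)
    (h : ∀ t ∈ l, R.rootMultiplicity t = M.count t) :
    ∃ A : ℂ, A ≠ 0 ∧ R = C A * (M.map fun x => X - C x).prod ∧ R.natDegree = M.card := by
  have : R.roots = M := Multiset.ext.2 fun t => by
    rw [count_roots]
    by_cases ht : t ∈ l
    · exact h t ht
    · rw [hoff t ht, Multiset.count_eq_zero_of_notMem fun h' => ht (hM t h')]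
  have hs := IsAlgClosed.splits R
  exact ⟨R.leadingCoeff, leadingCoeff_ne_zero.2 hR, by rw [← this]; exact hs.eq_prod_roots,
    by rw [← this]; exact hs.natDegree_eq_card_roots⟩

lemma rootMultiplicity_cubic (d x : ℂ) :
    (X * (X - 1) * (X - C d) : ℂ[X]).rootMultiplicity x = [0, 1, d].count x := by
  have e : (X * (X - 1) * (X - C d) : ℂ[X]) = ([0, 1, d].map fun x => X - C x).prod := by
    simp [mul_assoc]
  rw [e, ← count_roots, ← Multiset.coe_count]
  have := roots_multiset_prod_X_sub_C (([0, 1, d] : List ℂ) : Multiset ℂ)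
  rw [Multiset.map_coe, Multiset.prod_coe] at this
  rw [this]

lemma cubic_ne_zero (d : ℂ) : (X * (X - 1) * (X - C d) : ℂ[X]) ≠ 0 :=
  mul_ne_zero (mul_ne_zero X_ne_zero (by simpa using X_sub_C_ne_zero (1 : ℂ))) (X_sub_C_ne_zero d)

/-- A rational transformation is polynomial. -/
lemma Transforms.exists_polynomial {H : HeunEquation} {a b c : ℂ} {R : RatFunc ℂ}
    (hT : Transforms H a b c R) (h0 : H.d ≠ 0) (h1 : H.d ≠ 1) (hn : H.IsNontrivial) :
    ∃ P : ℂ[X], R = algebraMap ℂ[X] (RatFunc ℂ) P := by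
  obtain ⟨hconst, hT⟩ := hT
  set N := R.num with hN
  set M := R.denom with hM
  have hM0 : M ≠ 0 := R.denom_ne_zero
  have hev : ratEval R = fun t => N.eval t / M.eval t := by
    funext t
    simp only [ratEval, RatFunc.eval, eval₂_id]
    rfl
  have hN0 : N ≠ 0 := by
    intro h
    exact hconst 0 (by simpa using RatFunc.num_eq_zero_iff.1 h)
  have hNM : N - M ≠ 0 := by
    intro h
    refine hconst 1 ?_
    rw [← R.num_div_denom, ← hN, ← hM, sub_eq_zero.1 h, div_self, map_one]
    exact RatFunc.algebraMap_ne_zero hM0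
  have hlin : C (H.α * H.β) * X - C H.q ≠ 0 := by
    intro h
    have e0 := congrArg (eval 0) h
    have e1 := congrArg (eval 1) h
    simp at e0 e1
    rcases hn with hn | hn
    · exact hn (by simpa [e0] using e1)
    · exact hn e0
  set W := derivative N * M - N * derivative M with hW
  have key : (C (H.α * H.β) * X - C H.q) * (N * (N - M)) * (M * M) =
      C (a * b) * (W * W) * (X * (X - 1) * (X - C H.d)) := by
    refine eq_of_eventually_eval_eq ?_
    filter_upwards [hT, eventually_eval_ne_zero hM0, eventually_eval_ne_zero hN0,
      eventually_eval_ne_zero hNM, eventually_eval_ne_zero (cubic_ne_zero H.d)]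
      with t ⟨_, ht⟩ g1 g2 g3 g4
    have hd : deriv (ratEval R) t = W.eval t / M.eval t ^ 2 := by
      rw [hev]
      refine ((N.hasDerivAt t).fun_div (M.hasDerivAt t) g1).deriv.trans ?_
      simp [hW]
    rw [hd, hev] at ht
    simp only [coeffQ, hyperQ, eval_sub, eval_mul, eval_X, eval_one, eval_C] at *
    have e : N.eval t / M.eval t - 1 = (N.eval t - M.eval t) / M.eval t := by field_simp
    rw [e] at ht
    rw [div_eq_iff g4] at ht
    rw [ht]
    field_simp
  have hL : (C (H.α * H.β) * X - C H.q) * (N * (N - M)) * (M * M) ≠ 0 :=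
    mul_ne_zero (mul_ne_zero hlin (mul_ne_zero hN0 hNM)) (mul_ne_zero hM0 hM0)
  have hR := hL
  rw [key] at hR
  have hW0 : W ≠ 0 := by
    rintro h
    simp [h] at hR
  have hnoroot : ∀ x, ¬ M.IsRoot x := by
    intro x hx
    have hk : 0 < M.rootMultiplicity x := (rootMultiplicity_pos hM0).2 hx
    have hM' := derivative_rootMultiplicity_of_root hx
    have hM'0 : derivative M ≠ 0 := by
      rw [Ne, derivative_eq_zero, natDegree_eq_zero]
      rintro ⟨k, hk'⟩
      rw [← hk', IsRoot, eval_C] at hx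
      rw [← hk', hx, C_0] at hM0
      exact hM0 rfl
    have hNx : ¬ N.IsRoot x := by
      intro hNx
      obtain ⟨u, v, huv⟩ := R.isCoprime_num_denom
      have := congrArg (eval x) huv
      rw [eval_add, eval_mul, eval_mul, ← hN, ← hM, hx.eq_zero, hNx.eq_zero] at this
      simp at this
    have hWle : W.rootMultiplicity x < M.rootMultiplicity x := by
      by_contra hcon
      push Not at hcon
      rw [le_rootMultiplicity_iff hW0] at hcon
      have h2 : (X - C x) ^ M.rootMultiplicity x ∣ N * derivative M := by
        have h3 := dvd_sub ((pow_rootMultiplicity_dvd M x).mul_left (derivative N)) hcon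
        rwa [hW, sub_sub_cancel] at h3
      have h4 := (le_rootMultiplicity_iff (mul_ne_zero hN0 hM'0)).2 h2
      rw [rootMultiplicity_mul (mul_ne_zero hN0 hM'0), rootMultiplicity_eq_zero hNx, hM'] at h4
      omega
    have hcount : [0, 1, H.d].count x ≤ 1 :=
      List.nodup_iff_count_le_one.1 (by simp [h0.symm, h1.symm]) x
    have hlhs : (M.rootMultiplicity x + M.rootMultiplicity x) ≤
        ((C (H.α * H.β) * X - C H.q) * (N * (N - M)) * (M * M)).rootMultiplicity x := by
      rw [rootMultiplicity_mul hL, rootMultiplicity_mul (mul_ne_zero hM0 hM0)]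
      exact Nat.le_add_left _ _
    have hrhs : (C (a * b) * (W * W) * (X * (X - 1) * (X - C H.d))).rootMultiplicity x =
        W.rootMultiplicity x + W.rootMultiplicity x + [0, 1, H.d].count x := by
      rw [rootMultiplicity_mul hR, rootMultiplicity_mul (left_ne_zero_of_mul hR),
        rootMultiplicity_mul (mul_ne_zero hW0 hW0), rootMultiplicity_C, rootMultiplicity_cubic,
        zero_add]
    rw [key, hrhs] at hlhs
    omega
  have hM1 : M = 1 := by
    have hdeg : M.degree = 0 := by
      by_contra hdeg
      obtain ⟨x, hx⟩ := IsAlgClosed.exists_root M hdeg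
      exact hnoroot x hx
    exact R.monic_denom.eq_one_of_isUnit (isUnit_iff_degree_eq_zero.2 hdeg)
  refine ⟨N, ?_⟩
  rw [← R.num_div_denom, ← hN, ← hM, hM1, map_one, div_one]

/-- The consequences of a polynomial transformation on which the classification is based. -/
structure IsReducing (H : HeunEquation) (p c c' : ℂ) (R : ℂ[X]) : Prop where
  d_ne_zero : H.d ≠ 0
  d_ne_one : H.d ≠ 1
  q_eq : H.q = H.α * H.β * p
  exponent_ne : p ∈ [0, 1, H.d] → H.exponentAt p ≠ 0
  derivative_ne : derivative R ≠ 0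
  eqn : ∃ κ : ℂ, κ ≠ 0 ∧
    C κ * (X - C p) * R * (R - 1) = derivative R ^ 2 * (X * (X - 1) * (X - C H.d))
  exponent_eq : ∀ x, H.exponentAt x = c * R.rootMultiplicity x + c' * (R - 1).rootMultiplicity x
    - (derivative R).rootMultiplicity x

lemma Transforms.isReducing {H : HeunEquation} {a b c : ℂ} {P : ℂ[X]}
    (hT : Transforms H a b c (algebraMap ℂ[X] (RatFunc ℂ) P)) (h4 : H.HasFourSingularPoints)
    (hn : H.IsNontrivial) :
    H.α * H.β ≠ 0 ∧ IsReducing H (H.q / (H.α * H.β)) c (a + b - c + 1) P := by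
  rw [transforms_algebraMap_iff] at hT
  obtain ⟨hP', hT⟩ := hT
  obtain ⟨h0, h1, hs0, hs1, hsd, -⟩ := h4
  have hP0 := ne_zero_of_derivative hP'
  have hP1 := sub_one_ne_zero_of_derivative hP'
  have key : (C (H.α * H.β) * X - C H.q) * (P * (P - 1)) =
      C (a * b) * derivative P ^ 2 * (X * (X - 1) * (X - C H.d)) := by
    refine eq_of_eventually_eval_eq ?_
    filter_upwards [hT, eventually_eval_ne_zero hP0,
      eventually_eval_ne_zero hP1, eventually_eval_ne_zero (cubic_ne_zero H.d)]
      with t ⟨_, ht⟩ g2 g3 g4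
    simp only [coeffQ, hyperQ, eval_sub, eval_mul, eval_X, eval_one, eval_C, eval_pow] at *
    rw [div_eq_iff g4] at ht
    rw [ht]
    field_simp
  have hlin : C (H.α * H.β) * X - C H.q ≠ 0 := by
    intro h
    have e0 := congrArg (eval 0) h
    have e1 := congrArg (eval 1) h
    simp at e0 e1
    rcases hn with hn | hn
    · exact hn (by simpa [e0] using e1)
    · exact hn e0
  have hL := mul_ne_zero hlin (mul_ne_zero hP0 hP1)
  have hR := hL
  rw [key] at hR
  have hab : a * b ≠ 0 := by
    rintro h
    simp [h] at hR
  have hdeg : 0 < P.natDegree := by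
    rw [Nat.pos_iff_ne_zero]
    rwa [Ne, derivative_eq_zero] at hP'
  have hαβ : H.α * H.β ≠ 0 := by
    intro h
    have hd := congrArg natDegree key
    have hP1d : (P - 1).natDegree = P.natDegree := by
      simpa using natDegree_sub_C (p := P) (a := 1)
    have hcub : (X * (X - 1) * (X - C H.d) : ℂ[X]).natDegree = 3 := by
      rw [natDegree_mul (left_ne_zero_of_mul (cubic_ne_zero H.d)) (X_sub_C_ne_zero _),
        natDegree_mul X_ne_zero (by simpa using X_sub_C_ne_zero (1 : ℂ)), natDegree_X_sub_C,
        natDegree_X]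
      have : (X - 1 : ℂ[X]).natDegree = 1 := by simpa using natDegree_X_sub_C (1 : ℂ)
      rw [this]
    rw [natDegree_mul (left_ne_zero_of_mul hR) (cubic_ne_zero H.d), natDegree_C_mul hab,
      natDegree_pow, natDegree_mul hlin (mul_ne_zero hP0 hP1), natDegree_mul hP0 hP1, hP1d, hcub,
      natDegree_derivative, h] at hd
    simp at hd
    omega
  obtain ⟨hα, hβ⟩ := mul_ne_zero_iff.1 hαβ
  obtain ⟨ha, hb⟩ := mul_ne_zero_iff.1 hab
  refine ⟨hαβ, h0, h1, by field_simp, ?_, hP', ⟨H.α * H.β / (a * b), by positivity, ?_⟩, ?_⟩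
  · intro hp
    simp only [List.mem_cons, List.not_mem_nil, or_false] at hp
    rcases hp with hp | hp | hp
    · rw [hp, HeunEquation.exponentAt_zero]
      exact fun h => hs0 ⟨h, by rw [div_eq_iff hαβ] at hp; linear_combination hp⟩
    · rw [hp, HeunEquation.exponentAt_one]
      exact fun h => hs1 ⟨h, by rw [div_eq_iff hαβ] at hp; linear_combination hp⟩
    · rw [hp, HeunEquation.exponentAt_d h0 h1]
      exact fun h => hsd ⟨h, by rw [div_eq_iff hαβ] at hp; linear_combination hp⟩
  · refine Polynomial.funext fun t => ?_
    have := congrArg (eval t) key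
    simp only [eval_sub, eval_mul, eval_X, eval_one, eval_C, eval_pow] at this ⊢
    field_simp
    linear_combination this
  · intro x
    have l0 := tendsto_sub_mul_logDeriv hP0 x
    have l1 := tendsto_sub_mul_logDeriv hP1 x
    have l2 := tendsto_sub_mul_logDeriv hP' x
    refine tendsto_nhds_unique (HeunEquation.tendsto_sub_mul_coeffP h0 h1 x) ?_
    refine (((l0.const_mul c).add (l1.const_mul (a + b - c + 1))).sub l2).congr' ?_
    filter_upwards [punctured_le_cofinite x hT] with t ht
    rw [ht.1, hyperP]
    simp only [derivative_sub, derivative_one, sub_zero, eval_sub, eval_one]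
    ring

end HeunReduction

namespace HeunReduction

open ReductionType

lemma exists_perm_pattern (Q : ℂ → Prop) (a b c : ℂ) : ∃ x y z, [x, y, z].Perm [a, b, c] ∧
    (¬ Q x ∧ ¬ Q y ∧ ¬ Q z ∨ Q x ∧ ¬ Q y ∧ ¬ Q z ∨ Q x ∧ Q y ∧ ¬ Q z ∨ Q x ∧ Q y ∧ Q z) := by
  have h2 : [b, a, c].Perm [a, b, c] := List.Perm.swap a b [c]
  have h3 : [a, c, b].Perm [a, b, c] := (List.Perm.swap b c []).cons a
  have h4 : [b, c, a].Perm [a, b, c] := ((List.Perm.swap a c []).cons b).trans h2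
  have h5 : [c, a, b].Perm [a, b, c] := (List.Perm.swap a c [b]).trans h3
  by_cases qa : Q a <;> by_cases qb : Q b <;> by_cases qc : Q c
  · exact ⟨a, b, c, List.Perm.refl _, by tauto⟩
  · exact ⟨a, b, c, List.Perm.refl _, by tauto⟩
  · exact ⟨a, c, b, h3, by tauto⟩
  · exact ⟨a, b, c, List.Perm.refl _, by tauto⟩
  · exact ⟨b, c, a, h4, by tauto⟩
  · exact ⟨b, a, c, h2, by tauto⟩
  · exact ⟨c, a, b, h5, by tauto⟩
  · exact ⟨a, b, c, List.Perm.refl _, by tauto⟩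

namespace IsReducing

variable {H : HeunEquation} {p c c' : ℂ} {R : ℂ[X]}

lemma swap (h : IsReducing H p c c' R) : IsReducing H p c' c (1 - R) where
  d_ne_zero := h.d_ne_zero
  d_ne_one := h.d_ne_one
  q_eq := h.q_eq
  exponent_ne := h.exponent_ne
  derivative_ne := by simpa using h.derivative_ne
  eqn := by
    obtain ⟨κ, h1, h2⟩ := h.eqn
    refine ⟨κ, h1, ?_⟩
    simp only [derivative_sub, derivative_one, zero_sub]
    linear_combination h2
  exponent_eq := by
    intro x
    have hneg : ∀ f : ℂ[X], (-f).rootMultiplicity x = f.rootMultiplicity x := fun f => by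
      rw [← count_roots, ← count_roots, roots_neg]
    have e1 : 1 - R - 1 = -R := by ring
    have e2 : 1 - R = -(R - 1) := by ring
    have e3 : derivative (1 - R) = -derivative R := by simp
    rw [h.exponent_eq, e1, e3, e2, hneg, hneg, hneg]
    ring

lemma ne_zero (h : IsReducing H p c c' R) : R ≠ 0 := ne_zero_of_derivative h.derivative_ne

lemma sub_one_ne_zero (h : IsReducing H p c c' R) : R - 1 ≠ 0 :=
  sub_one_ne_zero_of_derivative h.derivative_ne

lemma rootMultiplicity_eq (h : IsReducing H p c c' R) (x : ℂ) :
    (if x = p then 1 else 0) + R.rootMultiplicity x + (R - 1).rootMultiplicity x =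
      2 * (derivative R).rootMultiplicity x + [0, 1, H.d].count x := by
  obtain ⟨κ, hκ, he⟩ := h.eqn
  have h1 : derivative R ^ 2 * (X * (X - 1) * (X - C H.d)) ≠ 0 :=
    mul_ne_zero (pow_ne_zero _ h.derivative_ne) (cubic_ne_zero _)
  have h2 := h1
  rw [← he] at h2
  have h3 := left_ne_zero_of_mul h2
  have h4 := left_ne_zero_of_mul h3
  have h5 : derivative R * derivative R ≠ 0 := mul_ne_zero h.derivative_ne h.derivative_ne
  have := congrArg (rootMultiplicity x) he
  rw [rootMultiplicity_mul h2, rootMultiplicity_mul h3, rootMultiplicity_mul h4,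
    rootMultiplicity_mul h1, rootMultiplicity_C, rootMultiplicity_X_sub_C, rootMultiplicity_cubic,
    sq, rootMultiplicity_mul h5, zero_add] at this
  rw [this, two_mul]

lemma nodup (h : IsReducing H p c c' R) : [0, 1, H.d].Nodup := by
  simp [h.d_ne_zero.symm, h.d_ne_one.symm]

lemma rootMultiplicity_cases (h : IsReducing H p c c' R) (x : ℂ) :
    (R.rootMultiplicity x = 0 ∧ (R - 1).rootMultiplicity x = 0) ∨
    (R.rootMultiplicity x = (derivative R).rootMultiplicity x + 1 ∧
      (R - 1).rootMultiplicity x = 0) ∨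
    (R.rootMultiplicity x = 0 ∧
      (R - 1).rootMultiplicity x = (derivative R).rootMultiplicity x + 1) := by
  have e : derivative (R - 1) = derivative R := by simp
  by_cases h0 : R.IsRoot x
  · have h1 : ¬ (R - 1).IsRoot x := by simp [IsRoot, h0.eq_zero]
    have := derivative_rootMultiplicity_of_root h0
    have h2 := (rootMultiplicity_pos h.ne_zero).2 h0
    exact Or.inr (Or.inl ⟨by omega, rootMultiplicity_eq_zero h1⟩)
  · by_cases h1 : (R - 1).IsRoot x
    · have := derivative_rootMultiplicity_of_root h1
      have h2 := (rootMultiplicity_pos h.sub_one_ne_zero).2 h1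
      rw [e] at this
      exact Or.inr (Or.inr ⟨rootMultiplicity_eq_zero h0, by omega⟩)
    · exact Or.inl ⟨rootMultiplicity_eq_zero h0, rootMultiplicity_eq_zero h1⟩

lemma eval_p (h : IsReducing H p c c' R) : R.eval p = 0 ∨ R.eval p = 1 := by
  by_contra! hcon
  have h0 : R.rootMultiplicity p = 0 := rootMultiplicity_eq_zero hcon.1
  have h1 : (R - 1).rootMultiplicity p = 0 :=
    rootMultiplicity_eq_zero (by simpa [IsRoot, sub_eq_zero] using hcon.2)
  have h2 := h.rootMultiplicity_eq p
  rw [h0, h1, if_pos rfl] at h2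
  have h3 : (derivative R).rootMultiplicity p = 0 := by omega
  have h4 : p ∈ [0, 1, H.d] := List.count_pos_iff.1 (by omega)
  exact h.exponent_ne h4 (by rw [h.exponent_eq, h0, h1, h3]; simp)

lemma exponentAt_of_not_mem {x : ℂ} (hx : x ∉ [0, 1, H.d]) : H.exponentAt x = 0 := by
  simp only [List.mem_cons, List.not_mem_nil, or_false, not_or] at hx
  simp [exponentAt, hx]

/-- The root of multiplicity `3`, if `p` is an ordinary point. -/
lemma of_not_mem (h : IsReducing H p c c' R) (hp : R.eval p = 0) (hmem : p ∉ [0, 1, H.d]) :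
    R.rootMultiplicity p = 3 ∧ c = 2 / 3 := by
  have h0 := (rootMultiplicity_pos h.ne_zero).2 hp
  have h1 := h.rootMultiplicity_eq p
  have h2 := h.rootMultiplicity_cases p
  have h3 := h.exponent_eq p
  rw [List.count_eq_zero_of_not_mem hmem, if_pos rfl] at h1
  rw [exponentAt_of_not_mem hmem] at h3
  have e1 : (R - 1).rootMultiplicity p = 0 := by omega
  have e2 : (derivative R).rootMultiplicity p = 2 := by omega
  have e3 : R.rootMultiplicity p = 3 := by omega
  rw [e1, e2, e3] at h3
  push_cast at h3
  exact ⟨e3, by linear_combination -h3 / 3⟩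

lemma of_mem (h : IsReducing H p c c' R) (hp : R.eval p = 0) (hmem : p ∈ [0, 1, H.d]) :
    R.rootMultiplicity p = 2 ∧ H.exponentAt p = 2 * c - 1 ∧ c ≠ 1 / 2 := by
  have h0 := (rootMultiplicity_pos h.ne_zero).2 hp
  have h1 := h.rootMultiplicity_eq p
  have h2 := h.rootMultiplicity_cases p
  have h3 := h.exponent_eq p
  rw [List.count_eq_one_of_mem h.nodup hmem, if_pos rfl] at h1
  have e1 : (R - 1).rootMultiplicity p = 0 := by omega
  have e2 : (derivative R).rootMultiplicity p = 1 := by omega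
  have e3 : R.rootMultiplicity p = 2 := by omega
  rw [e1, e2, e3] at h3
  push_cast at h3
  refine ⟨e3, by linear_combination h3, fun hc => h.exponent_ne hmem ?_⟩
  rw [h3, hc]; norm_num

lemma c_ne_half (h : IsReducing H p c c' R) (hp : R.eval p = 0) : c ≠ 1 / 2 := by
  by_cases hmem : p ∈ [0, 1, H.d]
  · exact (h.of_mem hp hmem).2.2
  · rw [(h.of_not_mem hp hmem).2]; norm_num

lemma rootMultiplicity_of_not_mem (h : IsReducing H p c c' R) (hp : R.eval p = 0) {x : ℂ}
    (hx : x ∉ [0, 1, H.d]) (hxp : x ≠ p) : R.rootMultiplicity x = 0 := by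
  have h1 := h.rootMultiplicity_eq x
  have h2 := h.rootMultiplicity_cases x
  have h3 := h.exponent_eq x
  rw [List.count_eq_zero_of_not_mem hx, if_neg hxp] at h1
  rw [exponentAt_of_not_mem hx] at h3
  by_contra hne
  have e1 : (R - 1).rootMultiplicity x = 0 := by omega
  have e2 : (derivative R).rootMultiplicity x = 1 := by omega
  have e3 : R.rootMultiplicity x = 2 := by omega
  rw [e1, e2, e3] at h3
  push_cast at h3
  exact h.c_ne_half hp (by linear_combination -h3 / 2)

lemma of_mem_of_ne (h : IsReducing H p c c' R) {x : ℂ}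
    (hx : x ∈ [0, 1, H.d]) (hxp : x ≠ p) : (derivative R).rootMultiplicity x = 0 ∧
      (R.eval x = 0 → R.rootMultiplicity x = 1 ∧ H.exponentAt x = c) ∧
      (R.eval x ≠ 0 → R.rootMultiplicity x = 0 ∧ H.exponentAt x = c') := by
  have h1 := h.rootMultiplicity_eq x
  have h2 := h.rootMultiplicity_cases x
  have h3 := h.exponent_eq x
  rw [List.count_eq_one_of_mem h.nodup hx, if_neg hxp] at h1
  have e0 : (derivative R).rootMultiplicity x = 0 := by omega
  refine ⟨e0, fun hr => ?_, fun hr => ?_⟩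
  · have := (rootMultiplicity_pos h.ne_zero).2 hr
    have e1 : (R - 1).rootMultiplicity x = 0 := by omega
    have e2 : R.rootMultiplicity x = 1 := by omega
    rw [e0, e1, e2] at h3
    exact ⟨e2, by simpa using h3⟩
  · have e2 : R.rootMultiplicity x = 0 := rootMultiplicity_eq_zero hr
    have e1 : (R - 1).rootMultiplicity x = 1 := by omega
    rw [e0, e1, e2] at h3
    exact ⟨e2, by simpa using h3⟩

/-- A critical point other than `p` forces exponents at the value `1`. -/
lemma c'_eq_half (h : IsReducing H p c c' R) (hp : R.eval p = 0) {w : ℂ} (hwp : w ≠ p)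
    (hw : (derivative R).eval w = 0) : c' = 1 / 2 := by
  have h0 := (rootMultiplicity_pos h.derivative_ne).2 hw
  have hmem : w ∉ [0, 1, H.d] := fun hmem => by
    have := (h.of_mem_of_ne hmem hwp).1
    omega
  have h1 := h.rootMultiplicity_eq w
  have h2 := h.rootMultiplicity_cases w
  have h3 := h.exponent_eq w
  rw [List.count_eq_zero_of_not_mem hmem, if_neg hwp,
    h.rootMultiplicity_of_not_mem hp hmem hwp] at h1
  rw [exponentAt_of_not_mem hmem, h.rootMultiplicity_of_not_mem hp hmem hwp] at h3
  have e1 : (R - 1).rootMultiplicity w = 2 := by omega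
  have e2 : (derivative R).rootMultiplicity w = 1 := by omega
  rw [e1, e2] at h3
  push_cast at h3
  linear_combination -h3 / 2

lemma eqn_eval (h : IsReducing H p c c' R) {x y z : ℂ} (hl : [x, y, z].Perm [0, 1, H.d]) :
    ∃ κ : ℂ, ∀ t, κ * (t - p) * R.eval t * (R.eval t - 1) =
      (derivative R).eval t ^ 2 * ((t - x) * (t - y) * (t - z)) := by
  obtain ⟨κ, -, he⟩ := h.eqn
  refine ⟨κ, fun t => ?_⟩
  have h1 := congrArg (eval t) he
  have h2 := (hl.map fun x => t - x).prod_eq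
  simp at h1 h2
  rw [mul_assoc (t - x), h2, h1]
  ring

set_option linter.unusedSimpArgs false in
/-- The classification when `p` is not a singular point. -/
lemma exists_type_of_not_mem (h : IsReducing H p c c' R) (hp : R.eval p = 0)
    (hmem : p ∉ [0, 1, H.d]) : ∃ τ : ReductionType, R.natDegree = τ.degree ∧ IsOfType τ H R := by
  obtain ⟨hm3, hc⟩ := h.of_not_mem hp hmem
  obtain ⟨x, y, z, hl, hpat⟩ := exists_perm_pattern (fun x => R.eval x = 0) 0 1 H.d
  have hnd := hl.nodup_iff.2 h.nodup
  simp only [List.nodup_cons, List.mem_cons, List.not_mem_nil, or_false, not_or, not_false_eq_true,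
    List.nodup_nil, and_true] at hnd
  obtain ⟨⟨hxy, hxz⟩, hyz⟩ := hnd
  rw [← hl.mem_iff] at hmem
  have hoff : ∀ t, t ∉ [p, x, y, z] → R.rootMultiplicity t = 0 := by
    intro t ht
    rw [List.mem_cons, not_or] at ht
    exact h.rootMultiplicity_of_not_mem hp (by rw [← hl.mem_iff]; exact ht.2) ht.1
  simp only [List.mem_cons, List.not_mem_nil, or_false, not_or] at hmem
  obtain ⟨hpx, hpy, hpz⟩ := hmem
  obtain ⟨-, hx1, hx0⟩ := h.of_mem_of_ne (hl.mem_iff.1 (by simp : x ∈ [x, y, z])) (Ne.symm hpx)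
  obtain ⟨-, hy1, hy0⟩ := h.of_mem_of_ne (hl.mem_iff.1 (by simp : y ∈ [x, y, z])) (Ne.symm hpy)
  obtain ⟨-, hz1, hz0⟩ := h.of_mem_of_ne (hl.mem_iff.1 (by simp : z ∈ [x, y, z])) (Ne.symm hpz)
  obtain ⟨κ, he⟩ := h.eqn_eval hl
  rcases hpat with ⟨qx, qy, qz⟩ | ⟨qx, qy, qz⟩ | ⟨qx, qy, qz⟩ | ⟨qx, qy, qz⟩
  · obtain ⟨A, hA, hR, hdeg⟩ := exists_eq_prod_of_rootMultiplicity (M := {p, p, p}) h.ne_zero (by simp) hoff (by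
        have e1 := (hx0 qx).1
        have e2 := (hy0 qy).1
        have e3 := (hz0 qz).1
        simp [Multiset.count_cons, Multiset.count_singleton, hm3, e1, e2, e3, hpx, hpy, hpz, hxy, hxz, hyz,
          Ne.symm hpx, Ne.symm hpy, Ne.symm hpz, Ne.symm hxy, Ne.symm hxz, Ne.symm hyz])
    have hRe : ∀ t, R.eval t = A * (t - p) ^ 3 := by
      intro t; rw [hR]; simp [-mul_eq_mul_left_iff, -mul_eq_mul_right_iff]; ring
    have hRd : ∀ t, (derivative R).eval t = 3 * A * (t - p) ^ 2 := by
      intro t; rw [hR]; simp [-mul_eq_mul_left_iff, -mul_eq_mul_right_iff]; ring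
    obtain ⟨c0, c1, c2, c3, -⟩ := coeffs_eq_zero (p := p)
      (a₀ := -κ + 9 * A * ((x - p) * (y - p) * (z - p)))
      (a₁ := -9 * A * ((x - p) * (y - p) + (y - p) * (z - p) + (z - p) * (x - p)))
      (a₂ := 9 * A * (x + y + z - 3 * p)) (a₃ := A * (κ - 9)) (a₄ := 0) (a₅ := 0) (a₆ := 0) (by
        filter_upwards [eventually_ne_cofinite p] with t ht
        have ht' := sub_ne_zero.2 ht
        have := he t
        rw [hRe, hRd] at this
        refine mul_left_cancel₀ (mul_ne_zero hA (pow_ne_zero 4 ht')) ?_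
        linear_combination this)
    have hκ : κ = 9 := sub_eq_zero.1 ((mul_eq_zero.1 c3).resolve_left hA)
    have hs : x + y + z - 3 * p = 0 := (mul_eq_zero.1 c2).resolve_left (mul_ne_zero (by norm_num) hA)
    have hpr := (mul_eq_zero.1 c1).resolve_left (mul_ne_zero (by norm_num) hA)
    refine ⟨equianharmonic, by rw [hdeg]; rfl, isOfType_equianharmonic (g := c') hl h.q_eq
      (sub_eq_zero.1 hs) hpr ?_ hRe ?_⟩
    · rw [hκ] at c0
      linear_combination c0 / 9 + A * (x - p) ^ 2 * hs - A * (x - p) * hpr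
    · intro t ht
      simp only [List.mem_cons, List.not_mem_nil, or_false] at ht
      rcases ht with rfl | rfl | rfl
      · exact (hx0 qx).2
      · exact (hy0 qy).2
      · exact (hz0 qz).2
  · obtain ⟨A, hA, hR, hdeg⟩ := exists_eq_prod_of_rootMultiplicity (M := {p, p, p, x}) h.ne_zero (by simp) hoff (by
        have e1 := (hx1 qx).1
        have e2 := (hy0 qy).1
        have e3 := (hz0 qz).1
        simp [Multiset.count_cons, Multiset.count_singleton, hm3, e1, e2, e3, hpx, hpy, hpz, hxy, hxz, hyz,
          Ne.symm hpx, Ne.symm hpy, Ne.symm hpz, Ne.symm hxy, Ne.symm hxz, Ne.symm hyz])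
    have hRe : ∀ t, R.eval t = A * (t - p) ^ 3 * (t - x) := by
      intro t; rw [hR]; simp [-mul_eq_mul_left_iff, -mul_eq_mul_right_iff]; ring
    have hRd : ∀ t, (derivative R).eval t = A * (t - p) ^ 2 * (4 * (t - p) - 3 * (x - p)) := by
      intro t; rw [hR]; simp [-mul_eq_mul_left_iff, -mul_eq_mul_right_iff]; ring
    obtain ⟨c0, -, c2, c3, c4, -⟩ := coeffs_eq_zero (p := p)
      (a₀ := -κ - 9 * A * (x - p) ^ 2 * ((y - p) * (z - p)))
      (a₁ := A * (9 * (x - p) ^ 2 * ((y - p) + (z - p)) + 24 * (x - p) * ((y - p) * (z - p))))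
      (a₂ := -A * (9 * (x - p) ^ 2 + 24 * (x - p) * ((y - p) + (z - p))
        + 16 * ((y - p) * (z - p))))
      (a₃ := A * (-κ * (x - p) + 24 * (x - p) + 16 * ((y - p) + (z - p))))
      (a₄ := A * (κ - 16)) (a₅ := 0) (a₆ := 0) (by
        filter_upwards [eventually_ne_cofinite p, eventually_ne_cofinite x] with t ht htx
        have ht' := sub_ne_zero.2 ht
        have htx' := sub_ne_zero.2 htx
        have := he t
        rw [hRe, hRd] at this
        refine mul_left_cancel₀ (mul_ne_zero hA (mul_ne_zero (pow_ne_zero 4 ht') htx')) ?_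
        linear_combination this)
    have hκ : κ = 16 := sub_eq_zero.1 ((mul_eq_zero.1 c4).resolve_left hA)
    have g3 := (mul_eq_zero.1 c3).resolve_left hA
    have g2 := (mul_eq_zero.1 c2).resolve_left (neg_ne_zero.2 hA)
    rw [hκ] at c0 g3
    have hsum : 2 * ((y - p) + (z - p)) = -(x - p) := by linear_combination g3 / 8
    have hprod : 16 * ((y - p) * (z - p)) = 3 * (x - p) ^ 2 := by
      linear_combination g2 - 12 * (x - p) * hsum
    have hc' : c' = 1 / 2 := by
      refine h.c'_eq_half hp (w := p + 3 / 4 * (x - p)) ?_ ?_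
      · intro hw
        exact hpx (by linear_combination -4 / 3 * hw)
      · rw [hRd]; ring
    refine ⟨quartic, by rw [hdeg]; rfl, isOfType_quartic hl h.q_eq hsum hprod ?_ hRe ?_ ?_ ?_⟩
    · linear_combination (-16 / 27) * c0 - 16 / 27 * 9 / 16 * A * (x - p) ^ 2 * hprod
    · rw [(hx1 qx).2, hc]
    · rw [(hy0 qy).2, hc']
    · rw [(hz0 qz).2, hc']
  · obtain ⟨A, hA, hR, hdeg⟩ := exists_eq_prod_of_rootMultiplicity (M := {p, p, p, x, y})
      h.ne_zero (by simp) hoff (by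
        have e1 := (hx1 qx).1
        have e2 := (hy1 qy).1
        have e3 := (hz0 qz).1
        simp [Multiset.count_cons, Multiset.count_singleton, hm3, e1, e2, e3, hpx, hpy, hpz, hxy, hxz, hyz,
          Ne.symm hpx, Ne.symm hpy, Ne.symm hpz, Ne.symm hxy, Ne.symm hxz, Ne.symm hyz])
    have hRe : ∀ t, R.eval t = A * (t - p) ^ 3 * (t - x) * (t - y) := by
      intro t; rw [hR]; simp [-mul_eq_mul_left_iff, -mul_eq_mul_right_iff]; ring
    have hRd : ∀ t, (derivative R).eval t = A * (t - p) ^ 2 * (5 * (t - p) ^ 2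
        - 4 * ((x - p) + (y - p)) * (t - p) + 3 * ((x - p) * (y - p))) := by
      intro t; rw [hR]; simp [-mul_eq_mul_left_iff, -mul_eq_mul_right_iff]; ring
    set e := (x - p) + (y - p) with hedef
    set f := (x - p) * (y - p) with hfdef
    obtain ⟨c0, -, -, c3, c4, c5, -⟩ := coeffs_eq_zero (p := p)
      (a₀ := -κ + 9 * A * f ^ 2 * (z - p))
      (a₁ := -A * (9 * f ^ 2 + 24 * e * f * (z - p)))
      (a₂ := A * (24 * e * f + (16 * e ^ 2 + 30 * f) * (z - p)))
      (a₃ := A * (κ * f - (16 * e ^ 2 + 30 * f) - 40 * e * (z - p)))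
      (a₄ := A * (-κ * e + 40 * e + 25 * (z - p)))
      (a₅ := A * (κ - 25)) (a₆ := 0) (by
        filter_upwards [eventually_ne_cofinite p, eventually_ne_cofinite x,
          eventually_ne_cofinite y] with t ht htx hty
        have ht' := sub_ne_zero.2 ht
        have htx' := sub_ne_zero.2 htx
        have hty' := sub_ne_zero.2 hty
        have := he t
        have hfac : (t - x) * (t - y) = (t - p) ^ 2 - e * (t - p) + f := by
          rw [hedef, hfdef]; ring
        have hRe' : R.eval t = A * (t - p) ^ 3 * ((t - p) ^ 2 - e * (t - p) + f) := by
          rw [hRe, mul_assoc _ (t - x), hfac]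
        rw [hfac, hRe', hRd] at this
        refine mul_left_cancel₀ (mul_ne_zero hA (mul_ne_zero (pow_ne_zero 4 ht')
          (mul_ne_zero htx' hty'))) ?_
        rw [hfac]
        linear_combination this)
    have hκ : κ = 25 := sub_eq_zero.1 ((mul_eq_zero.1 c5).resolve_left hA)
    have g3 := (mul_eq_zero.1 c3).resolve_left hA
    have g4 := (mul_eq_zero.1 c4).resolve_left hA
    rw [hκ] at c0 g3 g4
    have hsum : 3 * e = -5 * (z - p) := by linear_combination g4 / 5
    have hprod : 9 * f = 40 * (z - p) ^ 2 := by
      linear_combination -9 / 5 * g3 - (48 / 5 * e + 8 * (z - p)) * hsum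
    have hf0 : f ≠ 0 := mul_ne_zero (sub_ne_zero.2 (Ne.symm hpx)) (sub_ne_zero.2 (Ne.symm hpy))
    have hc' : c' = 1 / 2 := by
      obtain ⟨r, hr⟩ : ∃ r : ℂ, r ^ 2 = 16 * e ^ 2 - 60 * f :=
        IsAlgClosed.exists_pow_nat_eq _ (by norm_num)
      refine h.c'_eq_half hp (w := p + (4 * e + r) / 10) ?_ ?_
      · intro hw
        exact hf0 (by linear_combination (1 / 60) * hr - (r - 4 * e) / 6 * hw)
      · rw [hRd]
        linear_combination A * ((4 * e + r) / 10) ^ 2 / 20 * hr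
    refine ⟨quintic, by rw [hdeg]; rfl, isOfType_quintic hl h.q_eq hsum hprod ?_ hRe ?_ ?_ ?_⟩
    · linear_combination (9 / 1600) * c0
        - 9 / 1600 * 9 * A * (z - p) / 81 * (9 * f + 40 * (z - p) ^ 2) * hprod
    · rw [(hx1 qx).2, hc]
    · rw [(hy1 qy).2, hc]
    · rw [(hz0 qz).2, hc']
  · obtain ⟨A, hA, hR, hdeg⟩ := exists_eq_prod_of_rootMultiplicity (M := {p, p, p, x, y, z})
      h.ne_zero (by simp) hoff (by
        have e1 := (hx1 qx).1
        have e2 := (hy1 qy).1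
        have e3 := (hz1 qz).1
        simp [Multiset.count_cons, Multiset.count_singleton, hm3, e1, e2, e3, hpx, hpy, hpz, hxy, hxz, hyz,
          Ne.symm hpx, Ne.symm hpy, Ne.symm hpz, Ne.symm hxy, Ne.symm hxz, Ne.symm hyz])
    have hRe : ∀ t, R.eval t = A * (t - p) ^ 3 * ((t - x) * (t - y) * (t - z)) := by
      intro t; rw [hR]; simp [-mul_eq_mul_left_iff, -mul_eq_mul_right_iff]; ring
    have hRd : ∀ t, (derivative R).eval t = A * (t - p) ^ 2 * (6 * (t - p) ^ 3
        - 5 * (x + y + z - 3 * p) * (t - p) ^ 2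
        + 4 * ((x - p) * (y - p) + (y - p) * (z - p) + (z - p) * (x - p)) * (t - p)
        - 3 * ((x - p) * (y - p) * (z - p))) := by
      intro t; rw [hR]; simp [-mul_eq_mul_left_iff, -mul_eq_mul_right_iff]; ring
    have hfac : ∀ t, (t - x) * (t - y) * (t - z) = (t - p) ^ 3 - (x + y + z - 3 * p) * (t - p) ^ 2
        + ((x - p) * (y - p) + (y - p) * (z - p) + (z - p) * (x - p)) * (t - p)
        - (x - p) * (y - p) * (z - p) := by intro t; ring
    have hx3 := hfac x
    have hsum0 : x + y + z - 3 * p = (x - p) + (y - p) + (z - p) := by ring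
    set e := x + y + z - 3 * p with hedef
    set f := (x - p) * (y - p) + (y - p) * (z - p) + (z - p) * (x - p) with hfdef
    set g := (x - p) * (y - p) * (z - p) with hgdef
    obtain ⟨c0, -, -, -, c4, c5, c6⟩ := coeffs_eq_zero (p := p)
      (a₀ := -κ - 9 * A * g ^ 2)
      (a₁ := 24 * A * f * g)
      (a₂ := -A * (30 * e * g + 16 * f ^ 2))
      (a₃ := A * (-κ * g + 36 * g + 40 * e * f))
      (a₄ := A * (κ * f - 48 * f - 25 * e ^ 2))
      (a₅ := A * (-κ * e + 60 * e)) (a₆ := A * (κ - 36)) (by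
        filter_upwards [eventually_ne_cofinite p, eventually_ne_cofinite x,
          eventually_ne_cofinite y, eventually_ne_cofinite z] with t ht htx hty htz
        have ht' := sub_ne_zero.2 ht
        have htx' := sub_ne_zero.2 htx
        have hty' := sub_ne_zero.2 hty
        have htz' := sub_ne_zero.2 htz
        have := he t
        rw [hRe, hRd, hfac] at this
        refine mul_left_cancel₀ (mul_ne_zero hA (mul_ne_zero (pow_ne_zero 4 ht')
          (mul_ne_zero (mul_ne_zero htx' hty') htz'))) ?_
        rw [hfac]
        linear_combination this)
    have hκ : κ = 36 := sub_eq_zero.1 ((mul_eq_zero.1 c6).resolve_left hA)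
    have g4 := (mul_eq_zero.1 c4).resolve_left hA
    have g5 := (mul_eq_zero.1 c5).resolve_left hA
    rw [hκ] at c0 g4 g5
    have he0 : e = 0 := by linear_combination g5 / 24
    have hf0 : f = 0 := by linear_combination -g4 / 12 - 25 / 12 * e * he0
    have hxg : (x - p) ^ 3 = g := by
      rw [he0, hf0] at hx3
      linear_combination -hx3
    refine ⟨specialEquianharmonic, by rw [hdeg]; rfl,
      isOfType_specialEquianharmonic hl h.q_eq (sub_eq_zero.1 he0) hf0 ?_ hRe ?_⟩
    · linear_combination -c0 / 9 + A * ((x - p) ^ 3 + g) * hxg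
    · intro t ht
      simp only [List.mem_cons, List.not_mem_nil, or_false] at ht
      rcases ht with rfl | rfl | rfl
      · rw [(hx1 qx).2, hc]
      · rw [(hy1 qy).2, hc]
      · rw [(hz1 qz).2, hc]

set_option linter.unusedSimpArgs false in
/-- The classification when `p` is a singular point. -/
lemma exists_type_of_mem (h : IsReducing H p c c' R) (hp : R.eval p = 0)
    (hmem : p ∈ [0, 1, H.d]) : ∃ τ : ReductionType, R.natDegree = τ.degree ∧ IsOfType τ H R := by
  obtain ⟨hm2, hpexp, -⟩ := h.of_mem hp hmem
  obtain ⟨y, z, hl, hpat⟩ : ∃ y z, [y, p, z].Perm [0, 1, H.d] ∧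
      (R.eval y ≠ 0 ∧ R.eval z ≠ 0 ∨ R.eval y = 0 ∧ R.eval z ≠ 0 ∨ R.eval y = 0 ∧ R.eval z = 0) := by
    obtain ⟨y, z, hl⟩ : ∃ y z, [y, p, z].Perm [0, 1, H.d] := by
      simp only [List.mem_cons, List.not_mem_nil, or_false] at hmem
      rcases hmem with rfl | rfl | rfl
      · exact ⟨1, H.d, List.Perm.swap 0 1 [H.d]⟩
      · exact ⟨0, H.d, List.Perm.refl _⟩
      · exact ⟨0, 1, (List.Perm.swap 1 H.d []).cons 0⟩
    have hl' : [z, p, y].Perm [0, 1, H.d] :=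
      (List.Perm.swap p z [y]).trans
        (((List.Perm.swap y z []).cons p).trans ((List.Perm.swap y p [z]).trans hl))
    by_cases q1 : R.eval y = 0
    · exact ⟨y, z, hl, by tauto⟩
    · by_cases q2 : R.eval z = 0
      · exact ⟨z, y, hl', by tauto⟩
      · exact ⟨y, z, hl, by tauto⟩
  have hnd := hl.nodup_iff.2 h.nodup
  simp only [List.nodup_cons, List.mem_cons, List.not_mem_nil, or_false, not_or, not_false_eq_true,
    List.nodup_nil, and_true] at hnd
  obtain ⟨⟨hyp, hyz⟩, hpz⟩ := hnd
  have hoff : ∀ t, t ∉ [y, p, z] → R.rootMultiplicity t = 0 := by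
    intro t ht
    exact h.rootMultiplicity_of_not_mem hp (by rwa [← hl.mem_iff])
      (fun h => ht (by simp [h]))
  obtain ⟨-, hy1, hy0⟩ := h.of_mem_of_ne (hl.mem_iff.1 (by simp : y ∈ [y, p, z])) hyp
  obtain ⟨-, hz1, hz0⟩ := h.of_mem_of_ne (hl.mem_iff.1 (by simp : z ∈ [y, p, z])) (Ne.symm hpz)
  obtain ⟨κ, he⟩ := h.eqn_eval hl
  rcases hpat with ⟨qy, qz⟩ | ⟨qy, qz⟩ | ⟨qy, qz⟩
  · obtain ⟨A, hA, hR, hdeg⟩ := exists_eq_prod_of_rootMultiplicity (M := {p, p}) h.ne_zero (by simp) hoff (by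
        have e2 := (hy0 qy).1
        have e3 := (hz0 qz).1
        simp [Multiset.count_cons, Multiset.count_singleton, hm2, e2, e3, hpz, hyp, hyz,
          Ne.symm hyp, Ne.symm hpz, Ne.symm hyz])
    have hRe : ∀ t, R.eval t = A * (t - p) ^ 2 := by
      intro t; rw [hR]; simp [-mul_eq_mul_left_iff, -mul_eq_mul_right_iff]; ring
    have hRd : ∀ t, (derivative R).eval t = 2 * A * (t - p) := by
      intro t; rw [hR]; simp [-mul_eq_mul_left_iff, -mul_eq_mul_right_iff]; ring
    obtain ⟨c0, c1, c2, -⟩ := coeffs_eq_zero (p := p)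
      (a₀ := -κ - 4 * A * ((y - p) * (z - p))) (a₁ := 4 * A * (y + z - 2 * p))
      (a₂ := A * (κ - 4)) (a₃ := 0) (a₄ := 0) (a₅ := 0) (a₆ := 0) (by
        filter_upwards [eventually_ne_cofinite p] with t ht
        have ht' := sub_ne_zero.2 ht
        have := he t
        rw [hRe, hRd] at this
        refine mul_left_cancel₀ (mul_ne_zero hA (pow_ne_zero 3 ht')) ?_
        linear_combination this)
    have hκ : κ = 4 := sub_eq_zero.1 ((mul_eq_zero.1 c2).resolve_left hA)
    have hs := (mul_eq_zero.1 c1).resolve_left (mul_ne_zero (by norm_num) hA)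
    rw [hκ] at c0
    refine ⟨harmonic, by rw [hdeg]; rfl, isOfType_harmonic hl h.q_eq (sub_eq_zero.1 hs) ?_ hRe ?_⟩
    · linear_combination c0 / 4 + A * (y - p) * hs
    · rw [(hy0 qy).2, (hz0 qz).2]
  · obtain ⟨A, hA, hR, hdeg⟩ := exists_eq_prod_of_rootMultiplicity (M := {p, p, y}) h.ne_zero (by simp) hoff (by
        have e2 := (hy1 qy).1
        have e3 := (hz0 qz).1
        simp [Multiset.count_cons, Multiset.count_singleton, hm2, e2, e3, hpz, hyp, hyz,
          Ne.symm hyp, Ne.symm hpz, Ne.symm hyz])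
    have hRe : ∀ t, R.eval t = A * (t - p) ^ 2 * (t - y) := by
      intro t; rw [hR]; simp [-mul_eq_mul_left_iff, -mul_eq_mul_right_iff]; ring
    have hRd : ∀ t, (derivative R).eval t = A * (t - p) * (3 * (t - p) - 2 * (y - p)) := by
      intro t; rw [hR]; simp [-mul_eq_mul_left_iff, -mul_eq_mul_right_iff]; ring
    obtain ⟨c0, -, c2, c3, -⟩ := coeffs_eq_zero (p := p)
      (a₀ := -κ + 4 * A * (y - p) ^ 2 * (z - p))
      (a₁ := -A * (4 * (y - p) ^ 2 + 12 * (y - p) * (z - p)))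
      (a₂ := A * (-κ * (y - p) + 12 * (y - p) + 9 * (z - p)))
      (a₃ := A * (κ - 9)) (a₄ := 0) (a₅ := 0) (a₆ := 0) (by
        filter_upwards [eventually_ne_cofinite p, eventually_ne_cofinite y] with t ht hty
        have ht' := sub_ne_zero.2 ht
        have hty' := sub_ne_zero.2 hty
        have := he t
        rw [hRe, hRd] at this
        refine mul_left_cancel₀ (mul_ne_zero hA (mul_ne_zero (pow_ne_zero 3 ht') hty')) ?_
        linear_combination this)
    have hκ : κ = 9 := sub_eq_zero.1 ((mul_eq_zero.1 c3).resolve_left hA)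
    have g2 := (mul_eq_zero.1 c2).resolve_left hA
    rw [hκ] at c0 g2
    have hs : 3 * (z - p) = -(y - p) := by linear_combination g2 / 3
    have hc' : c' = 1 / 2 := by
      refine h.c'_eq_half hp (w := p + 2 / 3 * (y - p)) ?_ ?_
      · intro hw
        exact hyp (by linear_combination 3 / 2 * hw)
      · rw [hRd]; ring
    have hl' : [z, p, y].Perm [0, 1, H.d] :=
      (List.Perm.swap p z [y]).trans
        (((List.Perm.swap y z []).cons p).trans ((List.Perm.swap y p [z]).trans hl))
    refine ⟨realCubic, by rw [hdeg]; rfl, isOfType_realCubic hl' h.q_eq hs ?_ hRe ?_ ?_⟩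
    · linear_combination (-3 / 4) * c0 + A * (y - p) ^ 2 * hs
    · rw [(hz0 qz).2, hc']
    · rw [hpexp, (hy1 qy).2]; ring
  · obtain ⟨A, hA, hR, hdeg⟩ := exists_eq_prod_of_rootMultiplicity (M := {p, p, y, z}) h.ne_zero (by simp) hoff (by
        have e2 := (hy1 qy).1
        have e3 := (hz1 qz).1
        simp [Multiset.count_cons, Multiset.count_singleton, hm2, e2, e3, hpz, hyp, hyz,
          Ne.symm hyp, Ne.symm hpz, Ne.symm hyz])
    have hRe : ∀ t, R.eval t = A * (t - p) ^ 2 * (t - y) * (t - z) := by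
      intro t; rw [hR]; simp [-mul_eq_mul_left_iff, -mul_eq_mul_right_iff]; ring
    have hRd : ∀ t, (derivative R).eval t = A * (t - p) * (4 * (t - p) ^ 2
        - 3 * (y + z - 2 * p) * (t - p) + 2 * ((y - p) * (z - p))) := by
      intro t; rw [hR]; simp [-mul_eq_mul_left_iff, -mul_eq_mul_right_iff]; ring
    obtain ⟨c0, -, -, c3, c4, -⟩ := coeffs_eq_zero (p := p)
      (a₀ := -κ - 4 * A * ((y - p) * (z - p)) ^ 2)
      (a₁ := 12 * A * (y + z - 2 * p) * ((y - p) * (z - p)))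
      (a₂ := A * (κ * ((y - p) * (z - p)) - 16 * ((y - p) * (z - p)) - 9 * (y + z - 2 * p) ^ 2))
      (a₃ := A * (-κ * (y + z - 2 * p) + 24 * (y + z - 2 * p)))
      (a₄ := A * (κ - 16)) (a₅ := 0) (a₆ := 0) (by
        filter_upwards [eventually_ne_cofinite p, eventually_ne_cofinite y,
          eventually_ne_cofinite z] with t ht hty htz
        have ht' := sub_ne_zero.2 ht
        have hty' := sub_ne_zero.2 hty
        have htz' := sub_ne_zero.2 htz
        have := he t
        rw [hRe, hRd] at this
        refine mul_left_cancel₀ (mul_ne_zero hA (mul_ne_zero (pow_ne_zero 3 ht')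
          (mul_ne_zero hty' htz'))) ?_
        linear_combination this)
    have hκ : κ = 16 := sub_eq_zero.1 ((mul_eq_zero.1 c4).resolve_left hA)
    have g3 := (mul_eq_zero.1 c3).resolve_left hA
    rw [hκ] at c0 g3
    have hs : y + z - 2 * p = 0 := by linear_combination g3 / 8
    have hzp : z - p = -(y - p) := by linear_combination hs
    rw [hzp] at c0
    refine ⟨specialHarmonic, by rw [hdeg]; rfl,
      isOfType_specialHarmonic hl h.q_eq (sub_eq_zero.1 hs) ?_ hRe ?_ ?_⟩
    · linear_combination -c0 / 4
    · rw [(hy1 qy).2, (hz1 qz).2]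
    · rw [hpexp, (hy1 qy).2]; ring

lemma exists_type (h : IsReducing H p c c' R) :
    ∃ τ : ReductionType, R.natDegree = τ.degree ∧ IsOfType τ H R := by
  have main : ∀ {c c' : ℂ} {R : ℂ[X]}, IsReducing H p c c' R → R.eval p = 0 →
      ∃ τ : ReductionType, R.natDegree = τ.degree ∧ IsOfType τ H R := by
    intro c c' R h hp
    by_cases hmem : p ∈ [0, 1, H.d]
    · exact h.exists_type_of_mem hp hmem
    · exact h.exists_type_of_not_mem hp hmem
  rcases h.eval_p with hp | hp
  · exact main h hp
  · obtain ⟨τ, h1, h2⟩ := main h.swap (by simp [hp])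
    refine ⟨τ, ?_, h2.one_sub⟩
    rw [← h1]
    have : 1 - R = -(R - C 1) := by simp
    rw [this, natDegree_neg, natDegree_sub_C]

end IsReducing

end HeunReduction

namespace HeunReduction

open ReductionType

lemma ReductionType.D_ne_zero (τ : ReductionType) : τ.D ≠ 0 := by
  intro h
  cases τ <;> norm_num [ReductionType.D, Complex.ext_iff] at h

lemma ReductionType.D_ne_one (τ : ReductionType) : τ.D ≠ 1 := by
  intro h
  cases τ <;> norm_num [ReductionType.D, Complex.ext_iff] at h

lemma natDegree_poly (τ : ReductionType) : τ.poly.natDegree = τ.degree := by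
  have h1 : equianharmonic.p ≠ 0 := fun h => by
    have := equianharmonic_p_eq; norm_num [h] at this
  have h2 : quartic.p ≠ 0 := fun h => by
    have := quartic_p_eq; norm_num [h] at this
  have h3 : quartic.D ≠ 0 := quartic.D_ne_zero
  have h4 : specialEquianharmonic.p ≠ 0 := h1
  cases τ <;> simp only [ReductionType.poly, ReductionType.degree]
  · compute_degree!
  · compute_degree!
  · compute_degree!
  · compute_degree!
  · compute_degree!
  · compute_degree!
  · compute_degree!

lemma IsOfType.natDegree_eq {τ : ReductionType} {H : HeunEquation} {P : ℂ[X]}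
    (h : IsOfType τ H P) : P.natDegree = τ.degree := by
  obtain ⟨m, k, hm, -, -, -, h⟩ := h
  have hlin : (τ.poly.comp (C m * X + C k)).natDegree = τ.degree := by
    rw [natDegree_comp, natDegree_poly, natDegree_linear hm, mul_one]
  rcases h with h | h
  · rw [h, hlin]
  · have : 1 - P = -(P - C 1) := by simp
    rw [← hlin, ← h, this, natDegree_neg, natDegree_sub_C]

lemma IsOfType.mem_crossRatioOrbit {τ : ReductionType} {H : HeunEquation} {P : ℂ[X]}
    (h : IsOfType τ H P) (h0 : H.d ≠ 0) (h1 : H.d ≠ 1) : H.d ∈ crossRatioOrbit τ.D := by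
  obtain ⟨m, k, hm, himg, -⟩ := h
  have hD0 := τ.D_ne_zero
  have hD1 := sub_ne_zero.2 τ.D_ne_one
  have hD1' := sub_ne_zero.2 τ.D_ne_one.symm
  have e0 : k ∈ ({0, 1, τ.D} : Set ℂ) := himg ▸ ⟨0, by simp, by simp⟩
  have e1 : m + k ∈ ({0, 1, τ.D} : Set ℂ) := himg ▸ ⟨1, by simp, by simp⟩
  have ed : m * H.d + k ∈ ({0, 1, τ.D} : Set ℂ) := himg ▸ ⟨H.d, by simp, rfl⟩
  have hmd : m * (H.d - 1) ≠ 0 := mul_ne_zero hm (sub_ne_zero.2 h1)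
  have hmd0 : m * H.d ≠ 0 := mul_ne_zero hm h0
  set D := τ.D
  simp only [Set.mem_insert_iff, Set.mem_singleton_iff] at e0 e1 ed
  simp only [crossRatioOrbit, Set.mem_insert_iff, Set.mem_singleton_iff]
  rcases e0 with e0 | e0 | e0 <;> rcases e1 with e1 | e1 | e1 <;>
    first
    | exact absurd (by linear_combination e1 - e0 : m = 0) hm
    | skip
  all_goals
    rcases ed with ed | ed | ed <;>
    first
    | exact absurd (by linear_combination ed - e0 : m * H.d = 0) hmd0
    | exact absurd (by linear_combination ed - e1 : m * (H.d - 1) = 0) hmd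
    | skip
  · left
    linear_combination ed - e0 - H.d * (e1 - e0)
  · right; right; left
    rw [eq_div_iff hD0]
    linear_combination ed - e0 - H.d * (e1 - e0)
  · right; left
    linear_combination -(ed - e0 - H.d * (e1 - e0))
  · right; right; right; left
    rw [eq_div_iff hD1']
    linear_combination -(ed - e0 - H.d * (e1 - e0))
  · right; right; right; right; right
    rw [eq_div_iff hD0]
    linear_combination -(ed - e0 - H.d * (e1 - e0))
  · right; right; right; right; left
    rw [eq_div_iff hD1]
    linear_combination -(ed - e0 - H.d * (e1 - e0))

lemma mem_iff_of_mem_crossRatioOrbit {K : Subfield ℂ} {d D : ℂ} (h : d ∈ crossRatioOrbit D)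
    (h0 : D ≠ 0) (h1 : D ≠ 1) : d ∈ K ↔ D ∈ K := by
  have h1' := sub_ne_zero.2 h1
  have h1'' := sub_ne_zero.2 h1.symm
  have one := K.one_mem
  have hd : D ∈ K → d ∈ K := by
    intro hD
    rcases h with rfl | rfl | rfl | rfl | rfl | rfl
    exacts [hD, sub_mem one hD, div_mem one hD, div_mem one (sub_mem one hD),
      div_mem hD (sub_mem hD one), div_mem (sub_mem hD one) hD]
  refine ⟨fun hK => ?_, hd⟩
  rcases h with rfl | rfl | rfl | rfl | rfl | rfl
  · exact hK
  · simpa using sub_mem one hK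
  · simpa using inv_mem hK
  · simpa using sub_mem one (inv_mem hK)
  · have := inv_mem (sub_mem one (inv_mem hK))
    have e : (1 - (D / (D - 1))⁻¹)⁻¹ = D := by field_simp; ring
    rwa [e] at this
  · have := inv_mem (sub_mem one hK)
    have e : (1 - (D - 1) / D)⁻¹ = D := by field_simp; ring
    rwa [e] at this

lemma im_eq_zero_of_mem_crossRatioOrbit {σ τ : ReductionType} {d : ℂ}
    (hσ : d ∈ crossRatioOrbit σ.D) (hτ : d ∈ crossRatioOrbit τ.D) (h : σ.D.im = 0) :
    τ.D.im = 0 := by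
  have hK : ∀ x : ℂ, x ∈ Complex.ofRealHom.fieldRange ↔ x.im = 0 := fun x =>
    ⟨by rintro ⟨r, rfl⟩; simp, fun hx => ⟨x.re, by apply Complex.ext <;> simp [hx]⟩⟩
  rw [← hK, ← mem_iff_of_mem_crossRatioOrbit hτ τ.D_ne_zero τ.D_ne_one,
    mem_iff_of_mem_crossRatioOrbit hσ σ.D_ne_zero σ.D_ne_one, hK, h]

lemma eq_of_degree_eq {σ τ : ReductionType} {d : ℂ} (hσ : d ∈ crossRatioOrbit σ.D)
    (hτ : d ∈ crossRatioOrbit τ.D) (h : σ.degree = τ.degree) : σ = τ := by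
  have h1 := im_eq_zero_of_mem_crossRatioOrbit hσ hτ
  have h2 := im_eq_zero_of_mem_crossRatioOrbit hτ hσ
  cases σ <;> cases τ <;>
    first
    | rfl
    | (simp [ReductionType.degree] at h; done)
    | (norm_num [ReductionType.D] at h1; done)
    | norm_num [ReductionType.D] at h2

/-- The classification of the reductions. -/
lemma IsHlReduction.exists_type {H : HeunEquation} {a b c : ℂ} {R : RatFunc ℂ}
    (h4 : H.HasFourSingularPoints) (hn : H.IsNontrivial) (hR : IsHlReduction H a b c R) :
    H.α * H.β ≠ 0 ∧
      ∃ P : ℂ[X], R = algebraMap ℂ[X] (RatFunc ℂ) P ∧ P.natDegree ∈ Finset.Icc 2 6 ∧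
        ∃! τ : ReductionType,
          H.d ∈ crossRatioOrbit τ.D ∧ P.natDegree = τ.degree ∧ IsOfType τ H P := by
  obtain ⟨P, rfl⟩ := hR.transforms.exists_polynomial h4.1 h4.2.1 hn
  obtain ⟨hαβ, hred⟩ := hR.transforms.isReducing h4 hn
  obtain ⟨τ, hdeg, hτ⟩ := hred.exists_type
  have hd := hτ.mem_crossRatioOrbit h4.1 h4.2.1
  refine ⟨hαβ, P, rfl, ?_, τ, ⟨hd, hdeg, hτ⟩, fun σ hσ => ?_⟩
  · rw [hdeg]
    cases τ <;> simp [ReductionType.degree]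
  · exact eq_of_degree_eq hσ.1 hd (hσ.2.1.symm.trans hdeg)

lemma hasFourSingularPoints_of_ne_zero {H : HeunEquation} (h0 : H.d ≠ 0) (h1 : H.d ≠ 1)
    (hγ : H.γ ≠ 0) (hδ : H.δ ≠ 0) (hε : H.ε ≠ 0) (hαβ : H.α * H.β ≠ 0) :
    H.HasFourSingularPoints :=
  ⟨h0, h1, fun h => hγ h.1, fun h => hδ h.1, fun h => hε h.1, fun h => hαβ h.1⟩

lemma exists_isHlReductionOfType (τ : ReductionType) :
    ∃ (H : HeunEquation) (a b c : ℂ) (P : ℂ[X]),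
      H.HasFourSingularPoints ∧ H.IsNontrivial ∧ P.natDegree = τ.degree ∧
      IsHlReductionOfType τ H a b c P := by
  suffices h : ∃ (H : HeunEquation) (a b c : ℂ) (P : ℂ[X]), IsHlReductionOfType τ H a b c P ∧
      H.d = τ.D ∧ H.γ ≠ 0 ∧ H.δ ≠ 0 ∧ H.ε ≠ 0 ∧ H.α * H.β ≠ 0 by
    obtain ⟨H, a, b, c, P, h, hd, hγ, hδ, hε, hαβ⟩ := h
    exact ⟨H, a, b, c, P, hasFourSingularPoints_of_ne_zero (hd ▸ τ.D_ne_zero) (hd ▸ τ.D_ne_one)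
      hγ hδ hε hαβ, Or.inl hαβ, h.2.natDegree_eq, h⟩
  cases τ
  · refine ⟨_, _, _, _, _, isHlReductionOfType_harmonic (α := 1) (β := 1) (γ := 1)
      (notNonposInt_of_re_pos (by norm_num)), ?_⟩
    norm_num [ReductionType.D, HeunEquation.ε]
  · refine ⟨_, _, _, _, _, isHlReductionOfType_realCubic 1 1, ?_⟩
    norm_num [ReductionType.D, HeunEquation.ε]
  · refine ⟨_, _, _, _, _, isHlReductionOfType_specialHarmonic (α := 1) (β := 1)
      (notNonposInt_of_re_pos (by norm_num)), ?_⟩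
    norm_num [ReductionType.D, HeunEquation.ε]
  · refine ⟨_, _, _, _, _, isHlReductionOfType_equianharmonic (α := 1) (β := 1)
      equianharmonic_p_eq (notNonposInt_of_re_pos (by norm_num)), equianharmonic_D_eq.symm, ?_⟩
    norm_num [HeunEquation.ε]
  · refine ⟨_, _, _, _, _, isHlReductionOfType_quartic (α := 1 / 3)
      quartic_p_eq, quartic_D_eq.symm, ?_⟩
    norm_num [HeunEquation.ε]
  · refine ⟨_, _, _, _, _, isHlReductionOfType_quintic (α := 1 / 2)
      quintic_p_eq, quintic_D_eq.symm, ?_⟩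
    norm_num [HeunEquation.ε]
  · refine ⟨_, _, _, _, _, isHlReductionOfType_specialEquianharmonic (α := 1 / 2)
      equianharmonic_p_eq, equianharmonic_D_eq.symm, ?_⟩
    norm_num [HeunEquation.ε]

/-- The identity contained in a polynomial reduction. -/
lemma IsHlReductionOfType.identity {τ : ReductionType} {H : HeunEquation} {a b c : ℂ} {P : ℂ[X]}
    (h : IsHlReductionOfType τ H a b c P) {f : ℂ → ℂ} (hf : ∀ t, P.eval t = f t) :
    ∀ᶠ t in 𝓝 (0 : ℂ), Hl H.d H.q H.α H.β H.γ H.δ t = ₂F₁ a b c (f t) := by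
  filter_upwards [h.1.identity] with t ht
  rw [ht, ratEval_algebraMap, ← hf]

lemma sq_sub_self_of_eq_half_add {s p r : ℂ} {n : ℝ} (hs : s = 1 ∨ s = -1) (hn : 0 ≤ n)
    (hp : p = 1 / 2 + s * Complex.I * ((√n : ℝ) * r)) : p ^ 2 - p = -(n * r ^ 2 + 1 / 4) := by
  have h1 : ((√n : ℝ) : ℂ) ^ 2 = n := by exact_mod_cast Real.sq_sqrt hn
  have h2 : s ^ 2 = 1 := by rcases hs with rfl | rfl <;> norm_num
  have h3 : (s * Complex.I * ((√n : ℝ) * r)) ^ 2 = -(n * r ^ 2) := by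
    rw [mul_pow, mul_pow, mul_pow, h1, h2, Complex.I_sq]; ring
  rw [neg_add, ← h3, hp]; ring

end HeunReduction

theorem mainTheorem4 :
    -- The classification of all reductions.
    (∀ (H : HeunEquation) (a b c : ℂ) (R : RatFunc ℂ),
      H.HasFourSingularPoints → H.IsNontrivial → IsHlReduction H a b c R →
      H.α * H.β ≠ 0 ∧
      ∃ P : ℂ[X], R = algebraMap ℂ[X] (RatFunc ℂ) P ∧ P.natDegree ∈ Finset.Icc 2 6 ∧
        ∃! τ : ReductionType,
          H.d ∈ crossRatioOrbit τ.D ∧ P.natDegree = τ.degree ∧ IsOfType τ H P) ∧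
    -- Each of the seven types occurs.
    (∀ τ : ReductionType, ∃ (H : HeunEquation) (a b c : ℂ) (P : ℂ[X]),
      H.HasFourSingularPoints ∧ H.IsNontrivial ∧ P.natDegree = τ.degree ∧
      IsHlReductionOfType τ H a b c P) ∧
    -- The representative reductions with real `d`.
    (∀ α β γ : ℂ, NotNonposInt γ →
      IsHlReductionOfType .harmonic ⟨2, α * β, α, β, γ, α + β - 2 * γ + 1⟩
        (α / 2) (β / 2) γ (X * (2 - X)) ∧
      ∀ᶠ t in 𝓝 (0 : ℂ),
        Hl 2 (α * β) α β γ (α + β - 2 * γ + 1) t = ₂F₁ (α / 2) (β / 2) γ (t * (2 - t))) ∧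
    (∀ α β : ℂ,
      IsHlReductionOfType .realCubic ⟨4, α * β, α, β, 1 / 2, 2 * (α + β) / 3⟩
        (α / 3) (β / 3) (1 / 2) (1 - (X - 1) ^ 2 * (1 - C (1 / 4) * X)) ∧
      ∀ᶠ t in 𝓝 (0 : ℂ),
        Hl 4 (α * β) α β (1 / 2) (2 * (α + β) / 3) t =
          ₂F₁ (α / 3) (β / 3) (1 / 2 : ℂ) (1 - (t - 1) ^ 2 * (1 - t / 4))) ∧
    (∀ α β : ℂ, NotNonposInt ((α + β + 2) / 4) →
      IsHlReductionOfType .specialHarmonic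
        ⟨2, α * β, α, β, (α + β + 2) / 4, (α + β) / 2⟩
        (α / 4) (β / 4) ((α + β + 2) / 4) (1 - 4 * (X * (2 - X) - C (1 / 2)) ^ 2) ∧
      ∀ᶠ t in 𝓝 (0 : ℂ),
        Hl 2 (α * β) α β ((α + β + 2) / 4) ((α + β) / 2) t =
          ₂F₁ (α / 4) (β / 4) ((α + β + 2) / 4) (1 - 4 * (t * (2 - t) - 1 / 2) ^ 2)) ∧
    -- The representative reductions with non-real `d`; the two values of `s` are the signs.
    (∀ s : ℂ, s = 1 ∨ s = -1 →
      (∀ α β D p : ℂ, NotNonposInt ((α + β + 1) / 3) →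
        D = 1 / 2 + s * Complex.I * ((√3 : ℝ) / 2) →
        p = 1 / 2 + s * Complex.I * ((√3 : ℝ) / 6) →
        IsHlReductionOfType .equianharmonic
          ⟨D, α * β * p, α, β, (α + β + 1) / 3, (α + β + 1) / 3⟩
          (α / 3) (β / 3) ((α + β + 1) / 3) (1 - (1 - C (1 / p) * X) ^ 3) ∧
        ∀ᶠ t in 𝓝 (0 : ℂ),
          Hl D (α * β * p) α β ((α + β + 1) / 3) ((α + β + 1) / 3) t =
            ₂F₁ (α / 3) (β / 3) ((α + β + 1) / 3) (1 - (1 - t / p) ^ 3)) ∧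
      (∀ α D p : ℂ,
        D = 1 / 2 + s * Complex.I * (5 * (√2 : ℝ) / 4) →
        p = 1 / 2 + s * Complex.I * ((√2 : ℝ) / 4) →
        IsHlReductionOfType .quartic
          ⟨D, α * (2 / 3 - α) * p, α, 2 / 3 - α, 1 / 2, 1 / 2⟩
          (α / 4) (1 / 6 - α / 4) (1 / 2)
          (1 - (1 - C (1 / D) * X) * (1 - C (1 / p) * X) ^ 3) ∧
        ∀ᶠ t in 𝓝 (0 : ℂ),
          Hl D (α * (2 / 3 - α) * p) α (2 / 3 - α) (1 / 2) (1 / 2) t =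
            ₂F₁ (α / 4) (1 / 6 - α / 4) (1 / 2 : ℂ) (1 - (1 - t / D) * (1 - t / p) ^ 3)) ∧
      (∀ α D p : ℂ,
        D = 1 / 2 + s * Complex.I * (11 * (√15 : ℝ) / 90) →
        p = 1 / 2 + s * Complex.I * ((√15 : ℝ) / 18) →
        IsHlReductionOfType .quintic
          ⟨D, α * (5 / 6 - α) * p, α, 5 / 6 - α, 2 / 3, 2 / 3⟩
          (α / 5) (1 / 6 - α / 5) (2 / 3)
          (C (-s * Complex.I * (2025 * (√15 : ℝ) / 64)) * X * (X - 1) * (X - C p) ^ 3) ∧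
        ∀ᶠ t in 𝓝 (0 : ℂ),
          Hl D (α * (5 / 6 - α) * p) α (5 / 6 - α) (2 / 3) (2 / 3) t =
            ₂F₁ (α / 5) (1 / 6 - α / 5) (2 / 3 : ℂ)
              ((-s * Complex.I * (2025 * (√15 : ℝ) / 64)) * t * (t - 1) * (t - p) ^ 3)) ∧
      (∀ α D p : ℂ,
        D = 1 / 2 + s * Complex.I * ((√3 : ℝ) / 2) →
        p = 1 / 2 + s * Complex.I * ((√3 : ℝ) / 6) →
        IsHlReductionOfType .specialEquianharmonic
          ⟨D, α * (1 - α) * p, α, 1 - α, 2 / 3, 2 / 3⟩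
          (α / 6) (1 / 6 - α / 6) (2 / 3)
          (1 - 4 * ((1 - C (1 / p) * X) ^ 3 - C (1 / 2)) ^ 2) ∧
        ∀ᶠ t in 𝓝 (0 : ℂ),
          Hl D (α * (1 - α) * p) α (1 - α) (2 / 3) (2 / 3) t =
            ₂F₁ (α / 6) (1 / 6 - α / 6) (2 / 3 : ℂ)
              (1 - 4 * ((1 - t / p) ^ 3 - 1 / 2) ^ 2))) := by
  refine ⟨fun H a b c R h4 hn hR => hR.exists_type h4 hn, exists_isHlReductionOfType,
    fun α β γ hγ => ?_, fun α β => ?_, fun α β hγ => ?_,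
    fun s hs => ⟨fun α β D p hγ hD hp => ?_, fun α D p hD hp => ?_, fun α D p hD hp => ?_,
      fun α D p hD hp => ?_⟩⟩
  · have h := isHlReductionOfType_harmonic (α := α) (β := β) hγ
    exact ⟨h, h.identity fun t => by simp⟩
  · have h := isHlReductionOfType_realCubic α β
    exact ⟨h, h.identity fun t => by
      simp only [eval_mul, eval_C, eval_X, eval_sub, eval_one, eval_pow]; ring⟩
  · have h := isHlReductionOfType_specialHarmonic hγ
    exact ⟨h, h.identity fun t => by simp⟩
  · have hp2 : p ^ 2 - p + 1 / 3 = 0 := by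
      rw [sq_sub_self_of_eq_half_add (n := 3) (r := 1 / 6) hs (by norm_num) (by rw [hp]; ring)]
      norm_num
    obtain rfl : D = 3 * p - 1 := by rw [hD, hp]; ring
    have h := isHlReductionOfType_equianharmonic hp2 hγ
    exact ⟨h, h.identity fun t => by simp; ring⟩
  · have hp2 : p ^ 2 - p + 3 / 8 = 0 := by
      rw [sq_sub_self_of_eq_half_add (n := 2) (r := 1 / 4) hs (by norm_num) (by rw [hp]; ring)]
      norm_num
    obtain rfl : D = 5 * p - 2 := by rw [hD, hp]; ring
    have h := isHlReductionOfType_quartic (α := α) hp2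
    exact ⟨h, h.identity fun t => by simp; ring⟩
  · have hp2 : p ^ 2 - p + 8 / 27 = 0 := by
      rw [sq_sub_self_of_eq_half_add (n := 15) (r := 1 / 18) hs (by norm_num) (by rw [hp]; ring)]
      norm_num
    obtain rfl : D = 11 / 5 * p - 3 / 5 := by rw [hD, hp]; ring
    have h := isHlReductionOfType_quintic (α := α) hp2
    rw [show -(18225 / 32) * (p - 1 / 2) = -s * Complex.I * (2025 * (√15 : ℝ) / 64) by
      rw [hp]; ring] at h
    exact ⟨h, h.identity fun t => by
      simp only [eval_mul, eval_C, eval_X, eval_sub, eval_one, eval_pow]⟩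
  · have hp2 : p ^ 2 - p + 1 / 3 = 0 := by
      rw [sq_sub_self_of_eq_half_add (n := 3) (r := 1 / 6) hs (by norm_num) (by rw [hp]; ring)]
      norm_num
    obtain rfl : D = 3 * p - 1 := by rw [hD, hp]; ring
    have h := isHlReductionOfType_specialEquianharmonic (α := α) hp2
    exact ⟨h, h.identity fun t => by simp; ring⟩
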